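/- Let $k$ be a field of characteristic $p>0$ with $[k:k^p]<\infty$, and let $f\colon R\to S$ be a homomorphism of $k$-algebras of finite type. Assume that for every ${\mathfrak q}\in\operatorname{Spec}(R)$ the fiber ring $S\otimes_R k({\mathfrak q})$ is regular and of pure dimension $d$ (every irreducible component of its spectrum has dimension $d$). Let $\phi\colon S\to R$ be a ring homomorphism with $\phi\circ f=\mathrm{id}_R$, and for ${\mathfrak q}\in\operatorname{Spec}(R)$ put ${\mathfrak q}'=\phi^{-1}({\mathfrak q})$. Let ${\mathfrak a}$ be an ideal of $S$ such that ${\mathfrak a}\subseteq{\mathfrak q}'$ for all ${\mathfrak q}\in\operatorname{Spec}(R)$. Then for every real number $c\geq 0$, the set $$\{{\mathfrak q}\in\operatorname{Spec}(R)\mid \operatorname{fpt}({\mathfrak a}\cdot S_{{\mathfrak q}'}/{\mathfrak q}S_{{\mathfrak q}'})\geq c\}$$ is open in $\operatorname{Spec}(R)$. Here, for an ideal ${\mathfrak b}$ of an $F$-finite regular local ring $A$ of characteristic $p$ (a domain), $\operatorname{fpt}({\mathfrak b})$ is defined as follows. For an ideal $J$ of $A$ and $q=p^e$ let $J^{[q]}=(u^q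 : u\in J)$. For real $t\geq 0$, let $I^{*{\mathfrak b}^t}$ be the set of all $z\in A$ for which there is a nonzero $c\in A$ with $c\,z^q\,{\mathfrak b}^{\lceil tq\rceil}\subseteq I^{[q]}$ for all large $q=p^e$, and let $\tau({\mathfrak b}^t)=\bigcap_{I}(I: I^{*{\mathfrak b}^t})$, where $I$ runs through all ideals of $A$. If ${\mathfrak b}\neq 0$ is a proper ideal, $\operatorname{fpt}({\mathfrak b})$ is the smallest real number $\lambda>0$ such that $\tau({\mathfrak b}^\lambda)\neq\tau({\mathfrak b}^t)$ for every $0\leq t<\lambda$; moreover $\operatorname{fpt}(0)=0$. -/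

import Mathlib

open scoped ENNReal

namespace FThreshold

noncomputable section

variable {A : Type*} [CommRing A]

/-- The ideal `J^{[n]} = (u ^ n : u ∈ J)`; it is used for `n = p ^ e`, where `p` is the
characteristic of `A`. -/
def frobeniusPower (J : Ideal A) (n : ℕ) : Ideal A :=
  Ideal.span ((fun u : A => u ^ n) '' (J : Set A))

/-- `A°`, the complement of the union of the minimal primes of `A`. -/
def circ (A : Type*) [CommRing A] : Set A :=
  {c | ∀ P ∈ minimalPrimes A, c ∉ P}

/-- The `𝔞^t`-tight closure of `I`: the elements `z` for which there is `c ∈ A°` such that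
`c z^q 𝔞^⌈t q⌉ ⊆ I^{[q]}` for all large `q = p ^ e`. -/
def tightClosure (p : ℕ) (𝔞 : Ideal A) (t : ℝ) (I : Ideal A) : Set A :=
  {z | ∃ c ∈ circ A, ∃ e₀ : ℕ, ∀ e ≥ e₀, ∀ y ∈ 𝔞 ^ ⌈t * (p : ℝ) ^ e⌉₊,
    c * z ^ p ^ e * y ∈ frobeniusPower I (p ^ e)}

/-- The generalized test ideal `τ(𝔞^t) = ⋂_I (I : I^{*𝔞^t})`, where `I` runs through all ideals
of `A`. -/
def testIdeal (p : ℕ) (𝔞 : Ideal A) (t : ℝ) : Ideal A where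
  carrier := {x | ∀ I : Ideal A, ∀ z ∈ tightClosure p 𝔞 t I, x * z ∈ I}
  add_mem' := fun {x y} hx hy I z hz => by
    rw [add_mul]
    exact I.add_mem (hx I z hz) (hy I z hz)
  zero_mem' := fun I z _ => by
    rw [zero_mul]
    exact I.zero_mem
  smul_mem' := fun b x hx I z hz => by
    rw [smul_eq_mul, mul_assoc]
    exact I.mul_mem_left b (hx I z hz)

/-- The positive `F`-jumping exponents of `𝔞`: the real numbers `s > 0` such that
`τ(𝔞^s) ≠ τ(𝔞^t)` for every `0 ≤ t < s`. -/
def IsPosJumpingExponent (p : ℕ) (𝔞 : Ideal A) (s : ℝ) : Prop :=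
  0 < s ∧ ∀ t : ℝ, 0 ≤ t → t < s → testIdeal p 𝔞 s ≠ testIdeal p 𝔞 t

/-- The `F`-pure threshold of an ideal (of a regular local `F`-finite ring of characteristic `p`):
the smallest positive `F`-jumping exponent, with the usual convention `fpt(0) = 0`. If `𝔞` is the
unit ideal there is no positive jumping exponent, and the value is `∞`. -/
def fpt (p : ℕ) (𝔞 : Ideal A) : ℝ≥0∞ :=
  open scoped Classical in
  if 𝔞 = ⊥ then 0 else sInf (ENNReal.ofReal '' {s : ℝ | IsPosJumpingExponent p 𝔞 s})

/-- A ring has pure dimension `d` if all the irreducible components of its spectrum have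
dimension `d`. -/
def HasPureDimension (A : Type*) [CommRing A] (d : ℕ) : Prop :=
  ∀ P ∈ minimalPrimes A, ringKrullDim (A ⧸ P) = d

variable {R S : Type*} [CommRing R] [CommRing S] [Algebra R S]

/-- The ideal `𝔮 S_{𝔮'}` of `S_{𝔮'}`, for primes `𝔮` of `R` and `𝔮'` of `S`. -/
def extendedPrime (q : Ideal R) (q' : Ideal S) [q'.IsPrime] : Ideal (Localization.AtPrime q') :=
  (q.map (algebraMap R S)).map (algebraMap S (Localization.AtPrime q'))

/-- The ring `S_{𝔮'} / 𝔮 S_{𝔮'}`. -/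
abbrev LocalFiber (q : Ideal R) (q' : Ideal S) [q'.IsPrime] : Type _ :=
  Localization.AtPrime q' ⧸ extendedPrime q q'

/-- The ideal `𝔞 · S_{𝔮'} / 𝔮 S_{𝔮'}` of `S_{𝔮'} / 𝔮 S_{𝔮'}`. -/
def localFiberIdeal (𝔞 : Ideal S) (q : Ideal R) (q' : Ideal S) [q'.IsPrime] :
    Ideal (LocalFiber q q') :=
  (𝔞.map (algebraMap S (Localization.AtPrime q'))).map (Ideal.Quotient.mk (extendedPrime q q'))

end

end FThreshold

/-!
Write `S` as a quotient of a polynomial ring `R[X]` so that the section `φ` becomes evaluation at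
the origin. At a prime `𝔮₀` of `R` the Jacobian criterion selects as many relations as the
codimension of the fiber which, completed by some of the variables, form a system of coordinates at
the origin. Wherever their Jacobian determinant does not vanish the same relations cut out the local
fiber, because it is regular of the same dimension.

Let `y` be the product of the selected relations and let `f_j` lift the generators of `𝔞`. As in
Fedder's criterion, `∏ f_j^{i_j}` lies in the `p^e`-th Frobenius power of the maximal ideal of the
local fiber if and only if `y^{p^e - 1} ∏ f_j^{i_j}` lies in `(x_v^{p^e})`. So the `F`-pure
threshold is the supremum of the values `|i| / p^e` for which that product has a nonzero coefficient
at a suitable monomial, and `{fpt > c'}` is open.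

The degrees of `y` and the `f_j` do not depend on `𝔮`, so the `p^e`-th roots of these products span
ideals generated in bounded degree (Blickle–Mustaţă–Smith). Since multiplication by `p` acts on the
jumping exponents modulo integers, the thresholds lie in a finite set independent of `𝔮`; hence
`{fpt ≥ c}` coincides locally with `{fpt > c'}` for `c'` slightly smaller than `c`.
-/

namespace FThreshold

open IsLocalRing MvPolynomial

section FrobeniusPower

variable {A : Type*} [CommRing A]

theorem pow_mem_frobeniusPower {J : Ideal A} {x : A} (hx : x ∈ J) (n : ℕ) :
    x ^ n ∈ frobeniusPower J n :=
  Ideal.subset_span ⟨x, hx, rfl⟩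

theorem frobeniusPower_le_pow (J : Ideal A) (n : ℕ) : frobeniusPower J n ≤ J ^ n := by
  rw [frobeniusPower, Ideal.span_le]
  rintro _ ⟨x, hx, rfl⟩
  exact Ideal.pow_mem_pow hx n

theorem frobeniusPower_le_self (J : Ideal A) {n : ℕ} (hn : n ≠ 0) : frobeniusPower J n ≤ J :=
  (frobeniusPower_le_pow J n).trans (Ideal.pow_le_self hn)

theorem frobeniusPower_mono {I J : Ideal A} (h : I ≤ J) (n : ℕ) :
    frobeniusPower I n ≤ frobeniusPower J n :=
  Ideal.span_mono (Set.image_mono h)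

theorem prod_pow_mul_mem_frobeniusPower {I : Ideal A} {q : ℕ} (hq : q ≠ 0)
    {σ : Type*} {Y : σ → A} {s : Finset σ} (hY : ∀ v ∈ s, Y v ∈ I) {g : A}
    (hg : g ∈ frobeniusPower I q ⊔ Ideal.span (Y '' s)) :
    (∏ v ∈ s, Y v) ^ (q - 1) * g ∈ frobeniusPower I q := by
  classical
  suffices h : frobeniusPower I q ⊔ Ideal.span (Y '' s) ≤
      (frobeniusPower I q).colon {(∏ v ∈ s, Y v) ^ (q - 1)} by
    simpa only [smul_eq_mul, mul_comm] using Submodule.mem_colon_singleton.1 (h hg)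
  refine sup_le Ideal.le_colon (Ideal.span_le.2 ?_)
  rintro _ ⟨v, hv, rfl⟩
  refine Submodule.mem_colon_singleton.2 ?_
  rw [← Finset.mul_prod_erase s _ hv, mul_pow, smul_eq_mul, ← mul_assoc, ← pow_succ',
    Nat.sub_add_cancel (Nat.one_le_iff_ne_zero.2 hq)]
  exact Ideal.mul_mem_right _ _ (pow_mem_frobeniusPower (hY v hv) q)

variable (p : ℕ) [Fact p.Prime] [CharP A p]

theorem frobeniusPower_eq_map (J : Ideal A) (e : ℕ) :
    frobeniusPower J (p ^ e) = J.map (iterateFrobenius A p e) :=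
  rfl

theorem frobeniusPower_span (s : Set A) (e : ℕ) :
    frobeniusPower (Ideal.span s) (p ^ e) = Ideal.span ((fun u => u ^ p ^ e) '' s) :=
  Ideal.map_span (iterateFrobenius A p e) s

theorem map_frobeniusPower {B : Type*} [CommRing B] [CharP B p] (φ : A →+* B) (J : Ideal A)
    (e : ℕ) : (frobeniusPower J (p ^ e)).map φ = frobeniusPower (J.map φ) (p ^ e) := by
  simp only [frobeniusPower_eq_map, Ideal.map_map]
  congr 1
  ext x
  simp [iterateFrobenius_def]

theorem frobeniusPower_frobeniusPower (J : Ideal A) (e e' : ℕ) :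
    frobeniusPower (frobeniusPower J (p ^ e)) (p ^ e') = frobeniusPower J (p ^ (e + e')) := by
  simp only [frobeniusPower_eq_map, Ideal.map_map]
  congr 1
  ext x
  simp [iterateFrobenius_def, pow_add, pow_mul]

end FrobeniusPower

section FrobeniusColon

theorem cast_prime_pow_pos (p : ℕ) [hp : Fact p.Prime] (e : ℕ) : (0 : ℝ) < (p : ℝ) ^ e :=
  pow_pos (Nat.cast_pos.2 hp.out.pos) e

variable {A : Type*} [CommRing A] [IsLocalRing A] {p : ℕ}

/-- The inclusion `(I^{[q]} : z^q) ⊆ 𝔪^{[q]}` for `z ∉ I` and `q = p ^ e`. It follows from flatness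
of the Frobenius endomorphism, and it is the form in which the regularity of `A` enters the
computation of `F`-pure thresholds. -/
def HasFrobeniusColon (A : Type*) [CommRing A] [IsLocalRing A] (p : ℕ) : Prop :=
  ∀ (I : Ideal A) (z : A), z ∉ I → ∀ (e : ℕ) (c : A),
    c * z ^ p ^ e ∈ frobeniusPower I (p ^ e) → c ∈ frobeniusPower (maximalIdeal A) (p ^ e)

/-- The numbers `r / p ^ e` with `𝔟 ^ r ⊈ 𝔪^{[p ^ e]}`, whose supremum is the `F`-pure threshold
of `𝔟`. -/
def noncontainmentValues (p : ℕ) (𝔟 : Ideal A) : Set ℝ :=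
  {x | ∃ e r : ℕ, ¬ 𝔟 ^ r ≤ frobeniusPower (maximalIdeal A) (p ^ e) ∧ x = (r : ℝ) / (p : ℝ) ^ e}

theorem zero_mem_noncontainmentValues (𝔟 : Ideal A) : 0 ∈ noncontainmentValues p 𝔟 := by
  refine ⟨0, 0, fun h => (maximalIdeal.isMaximal A).ne_top (top_le_iff.1 ?_), by simp⟩
  simpa using h.trans (frobeniusPower_le_self _ (by simp))

theorem noncontainmentValues_bot_subset : noncontainmentValues p (⊥ : Ideal A) ⊆ {0} := by
  rintro _ ⟨e, r, h, rfl⟩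
  obtain rfl : r = 0 := by
    by_contra hr
    exact h (by simp [Ideal.bot_pow hr])
  simp

variable [Fact p.Prime]

theorem exists_not_pow_ceil_le_frobeniusPower {𝔟 : Ideal A} {t x : ℝ}
    (hx : x ∈ noncontainmentValues p 𝔟) (htx : t ≤ x) :
    ∃ e : ℕ, ¬ 𝔟 ^ ⌈t * (p : ℝ) ^ e⌉₊ ≤ frobeniusPower (maximalIdeal A) (p ^ e) := by
  obtain ⟨e, r, h, rfl⟩ := hx
  exact ⟨e, fun h' => h ((Ideal.pow_le_pow_right
    (Nat.ceil_le.2 ((le_div_iff₀ (cast_prime_pow_pos p e)).1 htx))).trans h')⟩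

theorem eq_zero_of_forall_mem_frobeniusPower [IsNoetherianRing A] {x : A} {e₀ : ℕ}
    (hx : ∀ e ≥ e₀, x ∈ frobeniusPower (maximalIdeal A) (p ^ e)) : x = 0 := by
  have h : x ∈ ⨅ i : ℕ, maximalIdeal A ^ i := by
    refine Ideal.mem_iInf.2 fun i => ?_
    have hi : i ≤ p ^ (e₀ + i) :=
      (Nat.le_add_left i e₀).trans (Nat.lt_pow_self (Fact.out : p.Prime).one_lt).le
    exact Ideal.pow_le_pow_right hi (frobeniusPower_le_pow _ _ (hx _ (Nat.le_add_right _ _)))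
  rwa [Ideal.iInf_pow_eq_bot_of_isLocalRing _ (maximalIdeal.isMaximal A).ne_top] at h

variable [CharP A p]

namespace HasFrobeniusColon

theorem mem_of_mul_pow_mem (H : HasFrobeniusColon A p) {u c : A} {e₁ e : ℕ}
    (hu : u ∉ frobeniusPower (maximalIdeal A) (p ^ e₁))
    (h : c * u ^ p ^ e ∈ frobeniusPower (maximalIdeal A) (p ^ (e₁ + e))) :
    c ∈ frobeniusPower (maximalIdeal A) (p ^ e) :=
  H _ u hu e c (by rwa [frobeniusPower_frobeniusPower])

variable [IsNoetherianRing A]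

theorem exists_lt_mem_noncontainmentValues (H : HasFrobeniusColon A p) {𝔟 : Ideal A} (h𝔟 : 𝔟 ≠ ⊥)
    {x : ℝ} (hx : x ∈ noncontainmentValues p 𝔟) : ∃ y ∈ noncontainmentValues p 𝔟, x < y := by
  obtain ⟨e, r, h, rfl⟩ := hx
  obtain ⟨u, hu, hum⟩ := SetLike.not_le_iff_exists.1 h
  obtain ⟨b, hb, hb0⟩ := Submodule.exists_mem_ne_zero_of_ne_bot h𝔟
  obtain ⟨e', he'⟩ : ∃ e', b ∉ frobeniusPower (maximalIdeal A) (p ^ e') := by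
    by_contra! hcon
    exact hb0 (eq_zero_of_forall_mem_frobeniusPower (e₀ := 0) fun e' _ => hcon e')
  refine ⟨_, ⟨e + e', r * p ^ e' + 1, fun hle => he' (H.mem_of_mul_pow_mem hum (hle ?_)), rfl⟩, ?_⟩
  · rw [pow_succ, mul_comm b, pow_mul]
    exact Ideal.mul_mem_mul (Ideal.pow_mem_pow hu _) hb
  · have hp := cast_prime_pow_pos p
    rw [div_lt_div_iff₀ (hp _) (hp _), pow_add]
    push_cast
    nlinarith [hp e]

theorem mem_of_mem_tightClosure (H : HasFrobeniusColon A p) {𝔟 I : Ideal A} {t : ℝ} {e₁ : ℕ}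
    (h : ¬ 𝔟 ^ ⌈t * (p : ℝ) ^ e₁⌉₊ ≤ frobeniusPower (maximalIdeal A) (p ^ e₁)) {z : A}
    (hz : z ∈ tightClosure p 𝔟 t I) : z ∈ I := by
  obtain ⟨u, hu, hum⟩ := SetLike.not_le_iff_exists.1 h
  obtain ⟨c, hc, e₀, hz⟩ := hz
  by_contra hzI
  have hu_pow (e : ℕ) : u ^ p ^ e ∈ 𝔟 ^ ⌈t * (p : ℝ) ^ (e₁ + e)⌉₊ := by
    refine Ideal.pow_le_pow_right (Nat.ceil_le.2 ?_)
      (pow_mul 𝔟 ⌈t * (p : ℝ) ^ e₁⌉₊ (p ^ e) ▸ Ideal.pow_mem_pow hu _)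
    rw [pow_add, ← mul_assoc, Nat.cast_mul, Nat.cast_pow]
    exact mul_le_mul_of_nonneg_right (Nat.le_ceil _) (by positivity)
  have hc0 : c = 0 := by
    refine eq_zero_of_forall_mem_frobeniusPower (p := p) (e₀ := e₀) fun e he =>
      H.mem_of_mul_pow_mem hum (H I z hzI _ _ ?_)
    rw [mul_right_comm]
    exact hz (e₁ + e) (he.trans (Nat.le_add_left _ _)) _ (hu_pow e)
  obtain ⟨P, hP⟩ := Ideal.nonempty_minimalPrimes (bot_ne_top (α := Ideal A))
  exact hc P hP (hc0 ▸ P.zero_mem)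

theorem testIdeal_eq_top_iff (H : HasFrobeniusColon A p) (𝔟 : Ideal A) (t : ℝ) :
    testIdeal p 𝔟 t = ⊤ ↔
      ∃ e : ℕ, ¬ 𝔟 ^ ⌈t * (p : ℝ) ^ e⌉₊ ≤ frobeniusPower (maximalIdeal A) (p ^ e) := by
  refine ⟨fun htop => ?_, fun ⟨e, he⟩ => ?_⟩
  · by_contra! hcon
    have one_mem : (1 : A) ∈ tightClosure p 𝔟 t (maximalIdeal A) :=
      ⟨1, fun P hP => (Ideal.IsMinimalPrime.isPrime hP).one_notMem, 0,
        fun e _ y hy => by simpa using hcon e hy⟩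
    have h := (htop ▸ Submodule.mem_top : (1 : A) ∈ testIdeal p 𝔟 t) _ _ one_mem
    exact (Ideal.IsMaximal.isPrime' (maximalIdeal A)).one_notMem (by simpa only [mul_one] using h)
  · rw [Ideal.eq_top_iff_one]
    intro I z hz
    simpa only [one_mul] using H.mem_of_mem_tightClosure he hz

theorem fpt_eq (H : HasFrobeniusColon A p) {𝔟 : Ideal A} {v : ℝ}
    (hv : IsLUB (noncontainmentValues p 𝔟) v) : fpt p 𝔟 = ENNReal.ofReal v := by
  by_cases h𝔟 : 𝔟 = ⊥
  · subst h𝔟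
    have hv0 : v ≤ 0 := hv.2 fun x hx => (noncontainmentValues_bot_subset hx).le
    rw [fpt, if_pos rfl, ENNReal.ofReal_of_nonpos hv0]
  have hlt (x) (hx : x ∈ noncontainmentValues p 𝔟) : x < v := by
    obtain ⟨y, hy, hxy⟩ := H.exists_lt_mem_noncontainmentValues h𝔟 hx
    exact hxy.trans_le (hv.1 hy)
  have hv0 : 0 < v := hlt 0 (zero_mem_noncontainmentValues 𝔟)
  have eq_top (t : ℝ) (ht : t < v) : testIdeal p 𝔟 t = ⊤ := by
    obtain ⟨x, hx, htx, -⟩ := hv.exists_between ht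
    exact (H.testIdeal_eq_top_iff 𝔟 t).2 (exists_not_pow_ceil_le_frobeniusPower hx htx.le)
  have ne_top : testIdeal p 𝔟 v ≠ ⊤ := fun h => by
    obtain ⟨e, he⟩ := (H.testIdeal_eq_top_iff 𝔟 v).1 h
    have h1 := hlt _ ⟨e, _, he, rfl⟩
    rw [div_lt_iff₀ (cast_prime_pow_pos p e)] at h1
    exact (Nat.le_ceil _).not_gt h1
  rw [fpt, if_neg h𝔟]
  refine IsLeast.csInf_eq ⟨⟨v, ⟨hv0, fun t _ ht => by rwa [eq_top t ht]⟩, rfl⟩, ?_⟩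
  rintro _ ⟨s, ⟨hs0, hs⟩, rfl⟩
  refine ENNReal.ofReal_le_ofReal (not_lt.1 fun hsv => ?_)
  exact hs 0 le_rfl hs0 (by rw [eq_top s hsv, eq_top 0 hv0])

end HasFrobeniusColon

end FrobeniusColon

section FrobeniusRoot

variable {σ K : Type*} [Field K] {p : ℕ} [Fact p.Prime]

theorem nsmul_add_right_injective {q : ℕ} (hq : q ≠ 0) (γ : σ →₀ ℕ) :
    Function.Injective fun δ : σ →₀ ℕ => q • δ + γ :=
  (add_left_injective γ).comp (nsmul_right_injective hq)

variable [CharP K p]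

theorem pow_char_pow_injective (K : Type*) [Field K] [CharP K p] (e : ℕ) :
    Function.Injective fun x : K => x ^ p ^ e :=
  iterateFrobenius_inj K p e

variable [PerfectRing K p]

variable (p) in
/-- The `p ^ e`-th root of the part of `F` whose exponents are `γ` modulo `p ^ e`, that is, the
polynomial with coefficients `δ ↦ F_{p ^ e δ + γ} ^ (1 / p ^ e)`. For `γ` with entries less than
`p ^ e` these are the coordinates of `F` in the basis of monomials over the subring of
`p ^ e`-th powers. -/
noncomputable def frobeniusRoot (e : ℕ) (γ : σ →₀ ℕ) (F : MvPolynomial σ K) : MvPolynomial σ K :=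
  ∑ δ ∈ F.support.preimage (fun δ => p ^ e • δ + γ)
      (nsmul_add_right_injective (NeZero.ne _) γ).injOn,
    monomial δ ((iterateFrobeniusEquiv K p e).symm (coeff (p ^ e • δ + γ) F))

theorem coeff_frobeniusRoot (e : ℕ) (γ δ : σ →₀ ℕ) (F : MvPolynomial σ K) :
    coeff δ (frobeniusRoot p e γ F) =
      (iterateFrobeniusEquiv K p e).symm (coeff (p ^ e • δ + γ) F) := by
  classical
  simp only [frobeniusRoot, coeff_sum, coeff_monomial, Finset.sum_ite_eq', Finset.mem_preimage]
  split_ifs with h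
  · rfl
  · rw [notMem_support_iff.1 h, map_zero]

theorem coeff_frobeniusRoot_pow (e : ℕ) (γ δ : σ →₀ ℕ) (F : MvPolynomial σ K) :
    coeff δ (frobeniusRoot p e γ F) ^ p ^ e = coeff (p ^ e • δ + γ) F := by
  rw [coeff_frobeniusRoot, ← iterateFrobenius_def, ← iterateFrobeniusEquiv_apply,
    RingEquiv.apply_symm_apply]

variable (p) in
/-- The map `frobeniusRoot p e γ`, which is linear over the inverse of the iterated Frobenius. -/
noncomputable def frobeniusRootₛₗ (e : ℕ) (γ : σ →₀ ℕ) :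
    MvPolynomial σ K →ₛₗ[((iterateFrobeniusEquiv K p e).symm : K →+* K)] MvPolynomial σ K where
  toFun := frobeniusRoot p e γ
  map_add' F G := by ext δ; simp [coeff_frobeniusRoot]
  map_smul' a F := by ext δ; simp [coeff_frobeniusRoot]

theorem totalDegree_frobeniusRoot_le {e M : ℕ} {F : MvPolynomial σ K}
    (hF : F.totalDegree ≤ p ^ e * M) (γ : σ →₀ ℕ) : (frobeniusRoot p e γ F).totalDegree ≤ M := by
  refine Finset.sup_le fun δ hδ => ?_
  have h : p ^ e • δ + γ ∈ F.support := by
    rw [mem_support_iff, ← coeff_frobeniusRoot_pow]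
    exact pow_ne_zero _ (mem_support_iff.1 hδ)
  have hdeg : (p ^ e • δ + γ).degree ≤ p ^ e * M := (le_totalDegree h).trans hF
  rw [map_add, map_nsmul, smul_eq_mul] at hdeg
  exact Nat.le_of_mul_le_mul_left ((Nat.le_add_right _ _).trans hdeg) (NeZero.pos _)

theorem frobeniusRoot_frobeniusRoot (e e' : ℕ) (β γ : σ →₀ ℕ) (F : MvPolynomial σ K) :
    frobeniusRoot p e' β (frobeniusRoot p e γ F) =
      frobeniusRoot p (e + e') (p ^ e • β + γ) F := by
  ext δ
  apply pow_char_pow_injective (p := p) K (e + e')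
  simp only
  rw [coeff_frobeniusRoot_pow, pow_add, mul_comm, pow_mul, coeff_frobeniusRoot_pow,
    coeff_frobeniusRoot_pow, smul_add, smul_smul, add_assoc, mul_comm]

theorem nsmul_le_nsmul_add_iff {q : ℕ} {γ : σ →₀ ℕ} (hγ : ∀ v, γ v < q) {a δ : σ →₀ ℕ} :
    q • a ≤ q • δ + γ ↔ a ≤ δ := by
  refine ⟨fun h v => ?_, fun h => (nsmul_le_nsmul_right h q).trans le_self_add⟩
  have hv : q * a v ≤ q * δ v + γ v := h v
  exact Nat.lt_succ_iff.1 <| Nat.lt_of_mul_lt_mul_left (a := q) <| by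
    rw [Nat.mul_succ]
    exact hv.trans_lt (Nat.add_lt_add_left (hγ v) _)

theorem frobeniusRoot_pow_mul {e : ℕ} {γ : σ →₀ ℕ} (hγ : ∀ v, γ v < p ^ e)
    (G F : MvPolynomial σ K) :
    frobeniusRoot p e γ (G ^ p ^ e * F) = G * frobeniusRoot p e γ F := by
  classical
  induction G using MvPolynomial.induction_on' with
  | add G₁ G₂ h₁ h₂ =>
    rw [add_pow_char_pow, add_mul, add_mul, ← h₁, ← h₂]
    exact map_add (frobeniusRootₛₗ p e γ) _ _
  | monomial a b =>
    ext δ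
    apply pow_char_pow_injective (p := p) K e
    simp only
    rw [coeff_frobeniusRoot_pow, monomial_pow, coeff_monomial_mul', coeff_monomial_mul']
    simp only [nsmul_le_nsmul_add_iff hγ]
    split_ifs with h
    · rw [mul_pow, coeff_frobeniusRoot_pow]
      obtain ⟨δ, rfl⟩ := le_iff_exists_add.1 h
      rw [smul_add, add_assoc, add_tsub_cancel_left, add_tsub_cancel_left]
    · rw [zero_pow (NeZero.ne _)]

end FrobeniusRoot

section MixedPower

/-- The product `y ^ (p ^ e - 1) * ∏ f_j ^ i_j`. The factor `y ^ (p ^ e - 1)` accounts for working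
modulo a regular sequence with product `y`, as in Fedder's criterion. -/
noncomputable def mixedPower {σ ι R : Type*} [Fintype ι] [CommRing R] (p : ℕ)
    (y : MvPolynomial σ R) (f : ι → MvPolynomial σ R) (e : ℕ) (i : ι → ℕ) : MvPolynomial σ R :=
  y ^ (p ^ e - 1) * ∏ j, f j ^ i j

theorem map_mixedPower {σ ι R L : Type*} [Fintype ι] [CommRing R] [CommRing L] (p : ℕ)
    (y : MvPolynomial σ R) (f : ι → MvPolynomial σ R) (g : R →+* L) (e : ℕ) (i : ι → ℕ) :
    map g (mixedPower p y f e i) = mixedPower p (map g y) (fun j => map g (f j)) e i := by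
  simp [mixedPower, map_prod]

variable {σ ι R : Type*} [Fintype ι] [CommRing R] {p : ℕ}
  {y : MvPolynomial σ R} {f : ι → MvPolynomial σ R}

theorem totalDegree_mixedPower_le {M : ℕ} (hM : y.totalDegree + ∑ j, (f j).totalDegree ≤ M)
    {e : ℕ} {i : ι → ℕ} (hi : ∀ j, i j < p ^ e) :
    (mixedPower p y f e i).totalDegree ≤ p ^ e * M :=
  calc (mixedPower p y f e i).totalDegree
      ≤ (y ^ (p ^ e - 1)).totalDegree + (∏ j, f j ^ i j).totalDegree := totalDegree_mul _ _
    _ ≤ (p ^ e - 1) * y.totalDegree + ∑ j, i j * (f j).totalDegree :=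
        add_le_add (totalDegree_pow _ _) ((totalDegree_finsetProd _ _).trans
          (Finset.sum_le_sum fun j _ => totalDegree_pow _ _))
    _ ≤ p ^ e * y.totalDegree + ∑ j, p ^ e * (f j).totalDegree :=
        add_le_add (Nat.mul_le_mul_right _ (Nat.sub_le _ _))
          (Finset.sum_le_sum fun j _ => Nat.mul_le_mul_right _ (hi j).le)
    _ ≤ p ^ e * M := by
        rw [← Finset.mul_sum, ← mul_add]
        exact Nat.mul_le_mul_left _ hM

theorem mixedPower_succ [Fact p.Prime] (y : MvPolynomial σ R) (f : ι → MvPolynomial σ R)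
    (e : ℕ) (d i : ι → ℕ) :
    mixedPower p y f (e + 1) (fun j => p ^ e * d j + i j) =
      mixedPower p y f 1 d ^ p ^ e * mixedPower p y f e i := by
  have hexp : p ^ (e + 1) - 1 = (p ^ 1 - 1) * p ^ e + (p ^ e - 1) := by
    have hp : 1 ≤ p := (Fact.out : p.Prime).one_le
    have hpe : 1 ≤ p ^ e := Nat.one_le_pow _ _ hp
    have : p ^ e ≤ p ^ (e + 1) := Nat.pow_le_pow_right hp (Nat.le_succ e)
    rw [Nat.sub_mul, pow_one, one_mul, ← pow_succ']
    omega
  simp only [mixedPower]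
  rw [hexp, pow_add, pow_mul, mul_pow, ← Finset.prod_pow]
  simp only [pow_add, Finset.prod_mul_distrib, mul_comm (p ^ e), pow_mul]
  ring

end MixedPower

section MixedRoots

variable {σ ι K : Type*} [Fintype ι] [Field K] {p : ℕ} [Fact p.Prime] [CharP K p]
  [PerfectRing K p]

/-- The `p ^ e`-th roots of the parts of the mixed powers `y ^ (p ^ e - 1) * ∏ f_j ^ i_j` with
`i_j < p ^ e` and `∑ i_j = r`. -/
def mixedRoots (p : ℕ) [Fact p.Prime] [CharP K p] [PerfectRing K p] (y : MvPolynomial σ K)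
    (f : ι → MvPolynomial σ K) (e r : ℕ) : Set (MvPolynomial σ K) :=
  {h | ∃ i : ι → ℕ, (∀ j, i j < p ^ e) ∧ ∑ j, i j = r ∧ ∃ γ : σ →₀ ℕ, (∀ v, γ v < p ^ e) ∧
    frobeniusRoot p e γ (mixedPower p y f e i) = h}

variable {y : MvPolynomial σ K} {f : ι → MvPolynomial σ K} {e r : ℕ} {h : MvPolynomial σ K}

theorem totalDegree_le_of_mem_mixedRoots {M : ℕ}
    (hM : y.totalDegree + ∑ j, (f j).totalDegree ≤ M) (hh : h ∈ mixedRoots p y f e r) :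
    h.totalDegree ≤ M := by
  obtain ⟨i, hi, -, γ, -, rfl⟩ := hh
  exact totalDegree_frobeniusRoot_le (totalDegree_mixedPower_le hM hi) γ

theorem frobeniusRoot_mul_frobeniusRoot_mixedPower {γ : σ →₀ ℕ} (hγ : ∀ v, γ v < p ^ e)
    (β : σ →₀ ℕ) (d i : ι → ℕ) :
    frobeniusRoot p 1 β (mixedPower p y f 1 d * frobeniusRoot p e γ (mixedPower p y f e i)) =
      frobeniusRoot p (e + 1) (p ^ e • β + γ)
        (mixedPower p y f (e + 1) fun j => p ^ e * d j + i j) := by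
  rw [← frobeniusRoot_pow_mul hγ, frobeniusRoot_frobeniusRoot, mixedPower_succ]

theorem pow_mul_add_lt_pow_succ {p e a b : ℕ} (ha : a < p) (hb : b < p ^ e) :
    p ^ e * a + b < p ^ (e + 1) :=
  calc p ^ e * a + b < p ^ e * (a + 1) := by rw [mul_add_one]; exact Nat.add_lt_add_left hb _
    _ ≤ p ^ (e + 1) := by rw [pow_succ]; exact Nat.mul_le_mul_left _ ha

theorem frobeniusRoot_mem_mixedRoots_succ (hh : h ∈ mixedRoots p y f e r) {d : ι → ℕ}
    (hd : ∀ j, d j < p) {β : σ →₀ ℕ} (hβ : ∀ v, β v < p) :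
    frobeniusRoot p 1 β (mixedPower p y f 1 d * h) ∈
      mixedRoots p y f (e + 1) (r + p ^ e * ∑ j, d j) := by
  obtain ⟨i, hi, rfl, γ, hγ, rfl⟩ := hh
  refine ⟨fun j => p ^ e * d j + i j, fun j => pow_mul_add_lt_pow_succ (hd j) (hi j), ?_,
    p ^ e • β + γ, fun v => pow_mul_add_lt_pow_succ (hβ v) (hγ v),
    (frobeniusRoot_mul_frobeniusRoot_mixedPower hγ β d i).symm⟩
  rw [Finset.sum_add_distrib, Finset.mul_sum, add_comm]

theorem exists_of_mem_mixedRoots_succ (hh : h ∈ mixedRoots p y f (e + 1) r) :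
    ∃ d : ι → ℕ, (∀ j, d j < p) ∧ ∃ β : σ →₀ ℕ, (∀ v, β v < p) ∧ ∃ r₀, ∃ h₀ ∈ mixedRoots p y f e r₀,
      r = r₀ + p ^ e * ∑ j, d j ∧ h = frobeniusRoot p 1 β (mixedPower p y f 1 d * h₀) := by
  obtain ⟨i, hi, rfl, γ, hγ, rfl⟩ := hh
  have hp : 0 < p ^ e := NeZero.pos _
  have hi_eq : i = fun j => p ^ e * (i j / p ^ e) + i j % p ^ e :=
    funext fun j => (Nat.div_add_mod _ _).symm
  obtain ⟨β, γ₀, hβ, hγ₀, rfl⟩ : ∃ β γ₀ : σ →₀ ℕ, (∀ v, β v < p) ∧ (∀ v, γ₀ v < p ^ e) ∧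
      γ = p ^ e • β + γ₀ := by
    refine ⟨γ.mapRange (· / p ^ e) (Nat.zero_div _), γ.mapRange (· % p ^ e) (Nat.zero_mod _),
      fun v => Nat.div_lt_of_lt_mul (by simpa only [pow_succ] using hγ v),
      fun v => Nat.mod_lt _ hp, ?_⟩
    ext v
    exact (Nat.div_add_mod _ _).symm
  refine ⟨fun j => i j / p ^ e, fun j => Nat.div_lt_of_lt_mul (by rw [← pow_succ]; exact hi j),
    β, hβ, ∑ j, i j % p ^ e, _,
    ⟨fun j => i j % p ^ e, fun j => Nat.mod_lt _ hp, rfl, γ₀, hγ₀, rfl⟩, ?_, ?_⟩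
  · rw [Finset.mul_sum, ← Finset.sum_add_distrib]
    exact Finset.sum_congr rfl fun j _ => (Nat.mod_add_div _ _).symm
  · rw [frobeniusRoot_mul_frobeniusRoot_mixedPower hγ₀, ← hi_eq]

end MixedRoots

section EscapeValues

variable {σ ι K : Type*} [Fintype ι] [Field K] {p : ℕ} [Fact p.Prime] [CharP K p]
  [PerfectRing K p]

/-- The numbers `r / p ^ e` for which `mixedRoots p y f e r` is not contained in `X`. -/
def escapeValues (p : ℕ) [Fact p.Prime] [CharP K p] [PerfectRing K p] (y : MvPolynomial σ K)
    (f : ι → MvPolynomial σ K) (X : Submodule K (MvPolynomial σ K)) : Set ℝ :=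
  {x | ∃ e r : ℕ, ∃ h ∈ mixedRoots p y f e r, h ∉ X ∧ x = (r : ℝ) / (p : ℝ) ^ e}

/-- The suprema of the sets `escapeValues p y f X`. -/
def thresholdValues (p : ℕ) [Fact p.Prime] [CharP K p] [PerfectRing K p] (y : MvPolynomial σ K)
    (f : ι → MvPolynomial σ K) : Set ℝ :=
  {v | ∃ X, IsLUB (escapeValues p y f X) v}

/-- The span of the roots of mixed powers of weight larger than `v`. -/
noncomputable def rootSpan (p : ℕ) [Fact p.Prime] [CharP K p] [PerfectRing K p]
    (y : MvPolynomial σ K) (f : ι → MvPolynomial σ K) (v : ℝ) : Submodule K (MvPolynomial σ K) :=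
  Submodule.span K {h | ∃ e r : ℕ, h ∈ mixedRoots p y f e r ∧ v < (r : ℝ) / (p : ℝ) ^ e}

/-- The number of monomials of degree at most `M` in the variables `σ`. -/
noncomputable def monomialCount (σ : Type*) (M : ℕ) : ℕ :=
  Nat.card {n : σ →₀ ℕ | (n.sum fun _ a => a) ≤ M}

/-- The subspace of the polynomials `h` for which all the roots of `y ^ (p - 1) * ∏ f_j ^ d_j * h`
lie in `X`. -/
noncomputable def rootColon (p : ℕ) [Fact p.Prime] [CharP K p] [PerfectRing K p]
    (y : MvPolynomial σ K) (f : ι → MvPolynomial σ K) (d : ι → ℕ)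
    (X : Submodule K (MvPolynomial σ K)) : Submodule K (MvPolynomial σ K) :=
  ⨅ (β : σ →₀ ℕ) (_ : ∀ v, β v < p),
    (X.comap (frobeniusRootₛₗ p 1 β)).comap (LinearMap.mulLeft K (mixedPower p y f 1 d))

variable {y : MvPolynomial σ K} {f : ι → MvPolynomial σ K} {X : Submodule K (MvPolynomial σ K)}

theorem mem_rootColon {d : ι → ℕ} {h : MvPolynomial σ K} :
    h ∈ rootColon p y f d X ↔
      ∀ β : σ →₀ ℕ, (∀ v, β v < p) → frobeniusRoot p 1 β (mixedPower p y f 1 d * h) ∈ X := by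
  simp only [rootColon, Submodule.mem_iInf]
  rfl

theorem rootSpan_strictAntiOn : StrictAntiOn (rootSpan p y f) (thresholdValues p y f) := by
  rintro v - v' ⟨X, hX⟩ hlt
  refine lt_of_le_of_ne (Submodule.span_mono ?_) fun heq => ?_
  · rintro g ⟨e, r, hg, hv'⟩
    exact ⟨e, r, hg, hlt.trans hv'⟩
  · obtain ⟨_, ⟨e, r, g, hg, hgX, rfl⟩, hv, -⟩ := hX.exists_between hlt
    have rootSpan_le : rootSpan p y f v' ≤ X := by
      refine Submodule.span_le.2 ?_
      rintro g' ⟨e', r', hg', hv'⟩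
      by_contra hgX'
      exact (hX.1 ⟨e', r', g', hg', hgX', rfl⟩).not_gt hv'
    exact hgX (rootSpan_le (heq ▸ Submodule.subset_span ⟨e, r, hg, hv⟩))

theorem thresholdValues_encard_le [Finite σ] {M : ℕ}
    (hM : y.totalDegree + ∑ j, (f j).totalDegree ≤ M) :
    (thresholdValues p y f).encard ≤ (monomialCount σ M + 1 : ℕ) := by
  have rootSpan_le (v) : rootSpan p y f v ≤ restrictTotalDegree σ K M :=
    Submodule.span_le.2 fun g ⟨_, _, hg, _⟩ =>
      (mem_restrictTotalDegree _ _ _).2 (totalDegree_le_of_mem_mixedRoots hM hg)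
  have finrank_eq : Module.finrank K (restrictTotalDegree σ K M) = monomialCount σ M :=
    Module.finrank_eq_nat_card_basis (basisRestrictSupport K _)
  have finite_rootSpan (v) : Module.Finite K (rootSpan p y f v) :=
    Submodule.finiteDimensional_of_le (rootSpan_le v)
  have mapsTo : Set.MapsTo (fun v => Module.finrank K (rootSpan p y f v)) (thresholdValues p y f)
      (Finset.range (monomialCount σ M + 1)) := fun v _ => by
    rw [Finset.mem_coe, Finset.mem_range_succ_iff, ← finrank_eq]
    exact Submodule.finrank_mono (rootSpan_le v)
  have injOn : Set.InjOn (fun v => Module.finrank K (rootSpan p y f v)) (thresholdValues p y f) :=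
    StrictAntiOn.injOn fun _ hv _ hv' h =>
      Submodule.finrank_lt_finrank_of_lt (rootSpan_strictAntiOn hv hv' h)
  rw [← Finset.card_range (monomialCount σ M + 1), ← Set.encard_coe_eq_coe_finsetCard]
  exact Set.encard_le_encard_of_injOn mapsTo injOn

theorem add_div_mem_escapeValues {d : ι → ℕ} (hd : ∀ j, d j < p) {x : ℝ}
    (hx : x ∈ escapeValues p y f (rootColon p y f d X)) :
    ((∑ j, d j : ℕ) + x) / p ∈ escapeValues p y f X := by
  obtain ⟨e, r, h, hh, hhX, rfl⟩ := hx
  obtain ⟨β, hβ, hβX⟩ : ∃ β : σ →₀ ℕ, (∀ v, β v < p) ∧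
      frobeniusRoot p 1 β (mixedPower p y f 1 d * h) ∉ X := by
    simpa only [mem_rootColon, not_forall, exists_prop] using hhX
  refine ⟨e + 1, _, _, frobeniusRoot_mem_mixedRoots_succ hh hd hβ, hβX, ?_⟩
  have hp : (p : ℝ) ≠ 0 := Nat.cast_ne_zero.2 (NeZero.ne p)
  push_cast
  field_simp
  ring

theorem escapeValues_subset :
    escapeValues p y f X ⊆ {0} ∪ ⋃ d : ι → Fin p, (fun x => ((∑ j, (d j : ℕ) : ℕ) + x) / (p : ℝ)) ''
      escapeValues p y f (rootColon p y f (fun j => d j) X) := by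
  rintro _ ⟨_ | e, r, h, hh, hhX, rfl⟩
  · obtain ⟨i, hi, rfl, -⟩ := hh
    have hi0 (j) : i j = 0 := Nat.lt_one_iff.1 (hi j)
    simp [hi0]
  · obtain ⟨d, hd, β, hβ, r₀, h₀, hh₀, rfl, rfl⟩ := exists_of_mem_mixedRoots_succ hh
    refine Or.inr (Set.mem_iUnion.2 ⟨fun j => ⟨d j, hd j⟩, _,
      ⟨e, r₀, h₀, hh₀, fun h => hhX (mem_rootColon.1 h β hβ), rfl⟩, ?_⟩)
    have hp : (p : ℝ) ≠ 0 := Nat.cast_ne_zero.2 (NeZero.ne p)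
    push_cast
    field_simp
    ring

theorem exists_mul_sub_mem_thresholdValues {v : ℝ} (hv : v ∈ thresholdValues p y f) (hv0 : v ≠ 0) :
    ∃ d : ℕ, p * v - d ∈ thresholdValues p y f := by
  obtain ⟨X, hX⟩ := hv
  have hp : (0 : ℝ) < p := by simpa using cast_prime_pow_pos p 1
  have mem_closure := closure_mono escapeValues_subset (hX.mem_closure hX.nonempty)
  rw [closure_union, closure_singleton, closure_iUnion_of_finite] at mem_closure
  obtain ⟨d, hd⟩ := Set.mem_iUnion.1 (mem_closure.resolve_left hv0)
  refine ⟨∑ j, (d j : ℕ), rootColon p y f (fun j => d j) X, ?_⟩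
  let φ : ℝ ≃o ℝ := (OrderIso.addLeft ((∑ j, (d j : ℕ) : ℕ) : ℝ)).trans (OrderIso.divRight₀ p hp)
  have isLUB_image : IsLUB (φ '' escapeValues p y f (rootColon p y f (fun j => d j) X)) v := by
    refine isLUB_of_mem_closure ?_ hd
    rintro _ ⟨x, hx, rfl⟩
    exact hX.1 (add_div_mem_escapeValues (fun j => (d j).2) hx)
  have hφ : v = φ (p * v - (∑ j, (d j : ℕ) : ℕ)) := by
    change v = (((∑ j, (d j : ℕ) : ℕ) : ℝ) + (p * v - (∑ j, (d j : ℕ) : ℕ))) / p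
    rw [add_sub_cancel, mul_div_cancel_left₀ v hp.ne']
  rw [hφ] at isLUB_image
  exact φ.isLUB_image'.1 isLUB_image

end EscapeValues

section PossibleThresholds

theorem exists_pow_sub_pow_mul_eq_int {F : Set ℝ} {N : ℕ} (hF : F.encard ≤ N) {b : ℤ}
    (hstep : ∀ x ∈ F, ∃ d : ℤ, b * x - d ∈ F) {v : ℝ} (hv : v ∈ F) :
    ∃ i i' : ℕ, i < i' ∧ i' ≤ N ∧ ∃ z : ℤ, ((b : ℝ) ^ i' - (b : ℝ) ^ i) * v = z := by
  have exists_mem (n : ℕ) : ∃ z : ℤ, b ^ n * v - z ∈ F := by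
    induction n with
    | zero => exact ⟨0, by simpa using hv⟩
    | succ n ih =>
      obtain ⟨z, hz⟩ := ih
      obtain ⟨d, hd⟩ := hstep _ hz
      refine ⟨b * z + d, ?_⟩
      convert hd using 1
      push_cast
      ring
  choose z hz using exists_mem
  have card_lt : F.encard < (Finset.range (N + 1) : Set ℕ).encard := by
    rw [Set.encard_coe_eq_coe_finsetCard, Finset.card_range]
    exact hF.trans_lt (by exact_mod_cast N.lt_succ_self)
  obtain ⟨i, hi, i', hi', hne, heq⟩ :=
    Set.exists_ne_map_eq_of_encard_lt_of_maps_to card_lt (f := fun n => (b : ℝ) ^ n * v - z n)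
      fun n _ => hz n
  rw [Finset.mem_coe, Finset.mem_range_succ_iff] at hi hi'
  rcases hne.lt_or_gt with h | h
  · exact ⟨i, i', h, hi', z i' - z i, by push_cast; linear_combination -heq⟩
  · exact ⟨i', i, h, hi, z i - z i', by push_cast; linear_combination heq⟩

/-- A finite set which contains all the thresholds of families of `l` polynomials of bounded
degree; the bound enters through `N`. -/
def possibleThresholds (p l N : ℕ) : Set ℝ :=
  {x | 0 ≤ x ∧ x ≤ l ∧ ∃ i i' : ℕ, i < i' ∧ i' ≤ N ∧ ∃ z : ℤ, ((p : ℝ) ^ i' - (p : ℝ) ^ i) * x = z}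

theorem possibleThresholds_finite {p : ℕ} (hp : p.Prime) (l N : ℕ) :
    (possibleThresholds p l N).Finite := by
  refine Set.Finite.subset ((Set.finite_Iic N).biUnion fun i _ => (Set.finite_Iic N).biUnion
    fun i' _ => (Set.finite_Icc 0 (p ^ i' * l : ℤ)).image
      fun z : ℤ => (z : ℝ) / ((p : ℝ) ^ i' - (p : ℝ) ^ i)) ?_
  rintro x ⟨hx0, hxl, i, i', hii', hi', z, hz⟩
  have hlt : (p : ℝ) ^ i < (p : ℝ) ^ i' :=
    pow_lt_pow_right₀ (by exact_mod_cast hp.one_lt) hii'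
  have hz0 : (0 : ℝ) ≤ z := hz ▸ mul_nonneg (sub_pos.2 hlt).le hx0
  have hzl : (z : ℝ) ≤ (p : ℝ) ^ i' * l :=
    hz ▸ mul_le_mul (sub_le_self _ (by positivity)) hxl hx0 (by positivity)
  simp only [Set.mem_iUnion]
  refine ⟨i, hii'.le.trans hi', i', hi', z, ⟨by exact_mod_cast hz0, by exact_mod_cast hzl⟩, ?_⟩
  simp only
  rw [← hz, mul_div_cancel_left₀ _ (sub_pos.2 hlt).ne']

end PossibleThresholds

section MixedValues

variable {σ ι K : Type*} [Fintype ι] [Field K] {p : ℕ}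
  {y : MvPolynomial σ K} {f : ι → MvPolynomial σ K}

/-- The values `|i| / p ^ e` of the mixed powers which are not in `(x_v ^ (p ^ e))`. -/
def mixedValues (p : ℕ) (y : MvPolynomial σ K) (f : ι → MvPolynomial σ K) : Set ℝ :=
  {x | ∃ (e : ℕ) (i : ι → ℕ) (γ : σ →₀ ℕ), (∀ j, i j < p ^ e) ∧ (∀ v, γ v < p ^ e) ∧
    coeff γ (mixedPower p y f e i) ≠ 0 ∧ x = (∑ j, i j : ℕ) / (p : ℝ) ^ e}

theorem mixedValues_map {L : Type*} [Field L] (g : K →+* L) :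
    mixedValues p (map g y) (fun j => map g (f j)) = mixedValues p y f := by
  ext x
  simp only [mixedValues, ← map_mixedPower, coeff_map, map_ne_zero]

theorem totalDegree_map_le {R L : Type*} [CommRing R] [CommRing L] (g : R →+* L)
    (F : MvPolynomial σ R) : (map g F).totalDegree ≤ F.totalDegree :=
  Finset.sup_mono (support_map_subset g F)

variable [Fact p.Prime]

theorem mixedValues_subset_Icc : mixedValues p y f ⊆ Set.Icc 0 (Fintype.card ι : ℝ) := by
  rintro _ ⟨e, i, γ, hi, -, -, rfl⟩
  refine ⟨by positivity, (div_le_iff₀ (cast_prime_pow_pos p e)).2 ?_⟩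
  have hsum : ∑ j, i j ≤ Fintype.card ι * p ^ e := by
    simpa using Finset.sum_le_card_nsmul _ _ _ fun j (_ : j ∈ Finset.univ) => (hi j).le
  exact_mod_cast hsum

theorem mixedValues_eq_escapeValues [CharP K p] [PerfectRing K p] :
    mixedValues p y f = escapeValues p y f (LinearMap.ker (lcoeff K (0 : σ →₀ ℕ))) := by
  have mem_ker (e : ℕ) (γ : σ →₀ ℕ) (F : MvPolynomial σ K) :
      frobeniusRoot p e γ F ∈ LinearMap.ker (lcoeff K 0) ↔ coeff γ F = 0 := by
    rw [LinearMap.mem_ker, lcoeff_apply, ← pow_eq_zero_iff (NeZero.ne (p ^ e)),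
      coeff_frobeniusRoot_pow, smul_zero, zero_add]
  ext x
  constructor
  · rintro ⟨e, i, γ, hi, hγ, hne, rfl⟩
    exact ⟨e, _, _, ⟨i, hi, rfl, γ, hγ, rfl⟩, (mem_ker e γ _).not.2 hne, rfl⟩
  · rintro ⟨e, r, h, ⟨i, hi, rfl, γ, hγ, rfl⟩, hker, rfl⟩
    exact ⟨e, i, γ, hi, hγ, (mem_ker e γ _).not.1 hker, rfl⟩

theorem mem_possibleThresholds [Finite σ] [CharP K p] {M : ℕ}
    (hM : y.totalDegree + ∑ j, (f j).totalDegree ≤ M) {v : ℝ} (hv : IsLUB (mixedValues p y f) v) :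
    v ∈ possibleThresholds p (Fintype.card ι) (monomialCount σ M + 2) := by
  obtain ⟨x, hx⟩ := hv.nonempty
  refine ⟨(mixedValues_subset_Icc hx).1.trans (hv.1 hx),
    hv.2 fun x hx => (mixedValues_subset_Icc hx).2, ?_⟩
  rw [← mixedValues_map (PerfectClosure.of K p), mixedValues_eq_escapeValues] at hv
  have degree_le := (add_le_add (totalDegree_map_le (PerfectClosure.of K p) y) (Finset.sum_le_sum
    fun j _ => totalDegree_map_le (PerfectClosure.of K p) (f j))).trans hM
  have encard_le := (Set.encard_insert_le _ (0 : ℝ)).trans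
    (add_le_add_left (thresholdValues_encard_le (p := p) degree_le) 1)
  refine exists_pow_sub_pow_mul_eq_int (b := p) encard_le (fun x hx => ?_) (Or.inr ⟨_, hv⟩)
  by_cases hx0 : x = 0
  · exact ⟨0, Or.inl (by simp [hx0])⟩
  · obtain ⟨d, hd⟩ := exists_mul_sub_mem_thresholdValues (hx.resolve_left hx0) hx0
    exact ⟨d, Or.inr (by exact_mod_cast hd)⟩

end MixedValues

section MonomialIdeal

variable {σ K : Type*} [CommRing K]

variable (σ K) in
/-- The ideal `(X_v ^ q : v ∈ σ)`, which is the Frobenius power `𝔫^{[q]}` of the ideal `𝔫` of the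
origin if `q` is a power of the characteristic. -/
noncomputable def varPowIdeal (q : ℕ) : Ideal (MvPolynomial σ K) :=
  Ideal.span (Set.range fun v => X v ^ q)

theorem mem_varPowIdeal_iff {q : ℕ} {f : MvPolynomial σ K} :
    f ∈ varPowIdeal σ K q ↔ ∀ γ : σ →₀ ℕ, (∀ v, γ v < q) → coeff γ f = 0 := by
  have h : varPowIdeal σ K q =
      Ideal.span ((fun s => monomial s (1 : K)) '' Set.range fun v => Finsupp.single v q) := by
    simp only [varPowIdeal, ← Set.range_comp, Function.comp_def, X_pow_eq_monomial]
  rw [h, mem_ideal_span_monomial_image]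
  simp only [Set.exists_range_iff, Finsupp.single_le_iff, mem_support_iff]
  refine forall_congr' fun γ => ?_
  rw [← not_imp_not, not_exists, not_not]
  simp only [not_le]

theorem exists_idealOfVars_pow_le_varPowIdeal [Finite σ] (q : ℕ) :
    ∃ N, idealOfVars σ K ^ N ≤ varPowIdeal σ K q := by
  cases nonempty_fintype σ
  refine ⟨Fintype.card σ * q + 1, fun f hf => mem_varPowIdeal_iff.2 fun γ hγ => ?_⟩
  refine (mem_pow_idealOfVars_iff' _ _).1 hf γ (Nat.lt_succ_iff.2 ?_)
  rw [Finsupp.degree_eq_sum, ← smul_eq_mul]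
  exact Finset.sum_le_card_nsmul _ _ _ fun v _ => (hγ v).le

theorem mem_idealOfVars_iff {f : MvPolynomial σ K} :
    f ∈ idealOfVars σ K ↔ constantCoeff f = 0 := by
  rw [← pow_one (idealOfVars σ K), mem_pow_idealOfVars_iff']
  simp only [Nat.lt_one_iff, Finsupp.degree_eq_zero_iff, forall_eq]
  rfl

theorem mem_sup_of_prod_X_pow_mul_mem {q : ℕ} {s : Finset σ} {f : MvPolynomial σ K}
    (hf : (∏ v ∈ s, X v) ^ (q - 1) * f ∈ varPowIdeal σ K q) :
    f ∈ varPowIdeal σ K q ⊔ Ideal.span (X '' s) := by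
  classical
  let β : σ →₀ ℕ := ∑ v ∈ s, Finsupp.single v (q - 1)
  have hβ (v : σ) : β v = if v ∈ s then q - 1 else 0 := by
    simp only [β, Finsupp.finsetSum_apply, Finsupp.single_apply, Finset.sum_ite_eq']
  have prod_eq : (∏ v ∈ s, X v : MvPolynomial σ K) ^ (q - 1) = monomial β 1 := by
    rw [← Finset.prod_pow, monomial_sum_one]
    exact Finset.prod_congr rfl fun v _ => X_pow_eq_monomial
  rw [mem_varPowIdeal_iff, prod_eq] at hf
  rw [f.as_sum]
  refine Ideal.sum_mem _ fun γ hγ => ?_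
  by_cases hs : ∃ v ∈ s, γ v ≠ 0
  · refine Ideal.mem_sup_right (mem_ideal_span_X_image.2 fun m hm => ?_)
    rwa [Finset.mem_singleton.1 (support_monomial_subset hm)]
  · refine Ideal.mem_sup_left (mem_varPowIdeal_iff.2 fun δ hδ => ?_)
    rw [coeff_monomial, ite_eq_right_iff]
    rintro rfl
    push Not at hs
    refine absurd (hf (β + γ) fun v => ?_) (by simpa [coeff_monomial_mul] using hγ)
    by_cases hv : v ∈ s
    · have := hδ v
      simp only [Finsupp.add_apply, hβ, if_pos hv, hs v hv]
      lia
    · simpa [hβ, hv] using hδ v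

variable {p : ℕ} [Fact p.Prime] [CharP K p]

variable (σ K p) in
theorem varPowIdeal_eq_frobeniusPower (e : ℕ) :
    varPowIdeal σ K (p ^ e) = frobeniusPower (idealOfVars σ K) (p ^ e) := by
  rw [idealOfVars, frobeniusPower_span, varPowIdeal, ← Set.range_comp]
  rfl

theorem pow_mem_varPowIdeal {f : MvPolynomial σ K} (hf : constantCoeff f = 0) (e : ℕ) :
    f ^ p ^ e ∈ varPowIdeal σ K (p ^ e) := by
  rw [varPowIdeal_eq_frobeniusPower]
  exact pow_mem_frobeniusPower (mem_idealOfVars_iff.2 hf) _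

theorem varPowIdeal_le_comap_aeval {Y : σ → MvPolynomial σ K}
    (hY : ∀ u, constantCoeff (Y u) = 0) (e : ℕ) :
    varPowIdeal σ K (p ^ e) ≤ (varPowIdeal σ K (p ^ e)).comap (aeval (R := K) Y) := by
  conv_lhs => rw [varPowIdeal]
  rw [Ideal.span_le]
  rintro _ ⟨v, rfl⟩
  simpa using pow_mem_varPowIdeal (hY v) e

end MonomialIdeal

section PolynomialColon

variable {σ K : Type*} [Field K]

instance isMaximal_idealOfVars : (idealOfVars σ K).IsMaximal := by
  have h : idealOfVars σ K = RingHom.ker (constantCoeff (σ := σ) (R := K)) :=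
    Ideal.ext fun _ => mem_idealOfVars_iff
  exact h ▸ RingHom.ker_isMaximal_of_surjective _ fun a => ⟨C a, constantCoeff_C σ a⟩

theorem le_idealOfVars_of_pow_le {I : Ideal (MvPolynomial σ K)} (hI : I ≠ ⊤) {N : ℕ}
    (hN : idealOfVars σ K ^ N ≤ I) : I ≤ idealOfVars σ K := by
  obtain ⟨M, hM, hIM⟩ := I.exists_le_maximal hI
  exact hIM.trans (isMaximal_idealOfVars.eq_of_le hM.ne_top
    (hM.isPrime.le_of_pow_le (hN.trans hIM))).ge

variable {p : ℕ} [Fact p.Prime] [CharP K p]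

theorem frobeniusRoot_mem [PerfectRing K p] {I : Ideal (MvPolynomial σ K)} {e : ℕ} {γ : σ →₀ ℕ}
    (hγ : ∀ v, γ v < p ^ e) {F : MvPolynomial σ K} (hF : F ∈ frobeniusPower I (p ^ e)) :
    frobeniusRoot p e γ F ∈ I := by
  suffices h : ∀ a, frobeniusRoot p e γ (a * F) ∈ I by simpa only [one_mul] using h 1
  induction hF using Submodule.span_induction with
  | mem _ h =>
    obtain ⟨u, hu, rfl⟩ := h
    intro a
    rw [mul_comm, frobeniusRoot_pow_mul hγ]
    exact I.mul_mem_right _ hu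
  | zero =>
    intro a
    have h : frobeniusRoot p e γ (0 : MvPolynomial σ K) = 0 := map_zero (frobeniusRootₛₗ p e γ)
    rw [mul_zero, h]
    exact I.zero_mem
  | add F G _ _ hF hG =>
    intro a
    have h : frobeniusRoot p e γ (a * F + a * G) = _ := map_add (frobeniusRootₛₗ p e γ) _ _
    rw [mul_add, h]
    exact I.add_mem (hF a) (hG a)
  | smul b F _ hF =>
    intro a
    rw [smul_eq_mul, ← mul_assoc]
    exact hF _

-- `c * z ^ q ∈ I^{[q]}` gives `z * r ∈ I` for the `q`-th roots `r` of the components of `c`, so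
-- all these roots lie in the proper ideal `(I : z)`, hence vanish at the origin.
theorem mem_varPowIdeal_of_mul_pow_mem_of_perfectRing [PerfectRing K p]
    {I : Ideal (MvPolynomial σ K)} {N : ℕ} (hN : idealOfVars σ K ^ N ≤ I) {z c : MvPolynomial σ K}
    (hz : z ∉ I) {e : ℕ} (hc : c * z ^ p ^ e ∈ frobeniusPower I (p ^ e)) :
    c ∈ varPowIdeal σ K (p ^ e) := by
  refine mem_varPowIdeal_iff.2 fun γ hγ => ?_
  have colon_ne_top : I.colon {z} ≠ ⊤ := fun h =>
    hz (by simpa using Submodule.mem_colon_singleton.1 ((Ideal.eq_top_iff_one _).1 h))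
  have root_mem : frobeniusRoot p e γ c ∈ I.colon {z} := by
    rw [Submodule.mem_colon_singleton, smul_eq_mul, mul_comm, ← frobeniusRoot_pow_mul hγ, mul_comm]
    exact frobeniusRoot_mem hγ hc
  have root_zero : coeff 0 (frobeniusRoot p e γ c) = 0 := mem_idealOfVars_iff.1 <|
    le_idealOfVars_of_pow_le colon_ne_top (hN.trans Ideal.le_colon) root_mem
  simpa [root_zero, zero_pow (NeZero.ne (p ^ e))] using
    (coeff_frobeniusRoot_pow (p := p) e γ 0 c).symm

attribute [local instance] algebraMvPolynomial in
theorem map_mem_map_iff (L : Type*) [Field L] [Algebra K L] {I : Ideal (MvPolynomial σ K)}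
    {z : MvPolynomial σ K} :
    map (algebraMap K L) z ∈ I.map (map (σ := σ) (algebraMap K L)) ↔ z ∈ I := by
  have : Module.FaithfullyFlat (MvPolynomial σ K) (MvPolynomial σ L) :=
    .of_linearEquiv _ _ (Algebra.IsPushout.equiv K (MvPolynomial σ K) L (MvPolynomial σ L)
      |>.symm.toLinearEquiv)
  exact SetLike.ext_iff.1
    (Ideal.comap_map_eq_self_of_faithfullyFlat (B := MvPolynomial σ L) I) z

theorem mem_varPowIdeal_of_mul_pow_mem {I : Ideal (MvPolynomial σ K)} {N : ℕ}
    (hN : idealOfVars σ K ^ N ≤ I) {z c : MvPolynomial σ K} (hz : z ∉ I) {e : ℕ}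
    (hc : c * z ^ p ^ e ∈ frobeniusPower I (p ^ e)) : c ∈ varPowIdeal σ K (p ^ e) := by
  let L := AlgebraicClosure K
  have : CharP L p := charP_of_injective_algebraMap (algebraMap K L).injective p
  have : PerfectRing L p := PerfectField.toPerfectRing p
  let φ : MvPolynomial σ K →+* MvPolynomial σ L := map (algebraMap K L)
  have map_vars : (idealOfVars σ K).map φ = idealOfVars σ L := by
    rw [idealOfVars, Ideal.map_span, ← Set.range_comp]
    simp [φ, Function.comp_def, idealOfVars]
  have key : φ c ∈ varPowIdeal σ L (p ^ e) := by
    refine mem_varPowIdeal_of_mul_pow_mem_of_perfectRing (I := I.map φ) (N := N) (z := φ z) ?_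
      (fun h => hz ((map_mem_map_iff L).1 h)) ?_
    · rw [← map_vars, ← Ideal.map_pow]
      exact Ideal.map_mono hN
    · rw [← map_frobeniusPower p φ, ← map_pow, ← map_mul]
      exact Ideal.mem_map_of_mem φ hc
  refine mem_varPowIdeal_iff.2 fun γ hγ => (algebraMap K L).injective ?_
  rw [map_zero, ← coeff_map]
  exact mem_varPowIdeal_iff.1 key γ hγ

end PolynomialColon

section Coordinates

variable {σ K : Type*}

/-- The Jacobian matrix at the origin of a family of polynomials. -/
noncomputable def jacobianMatrix [CommRing K] (Y : σ → MvPolynomial σ K) : Matrix σ σ K :=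
  fun u v => coeff (Finsupp.single v 1) (Y u)

theorem mem_idealOfVars_sq_iff [CommRing K] {f : MvPolynomial σ K} :
    f ∈ idealOfVars σ K ^ 2 ↔
      f ∈ idealOfVars σ K ∧ ∀ v, coeff (Finsupp.single v 1) f = 0 := by
  rw [mem_pow_idealOfVars_iff', mem_idealOfVars_iff]
  refine ⟨fun h => ⟨h 0 (by simp), fun v => h _ (by simp)⟩, fun ⟨h₀, h₁⟩ γ hγ => ?_⟩
  rcases Nat.lt_succ_iff_lt_or_eq.1 hγ with h | h
  · rwa [Finsupp.degree_eq_zero_iff γ |>.1 (Nat.lt_one_iff.1 h)]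
  · obtain ⟨v, rfl⟩ : γ ∈ Set.range fun v => Finsupp.single v 1 := by
      rwa [Finsupp.range_single_one]
    exact h₁ v

variable [Fintype σ] [DecidableEq σ] [Field K] {Y : σ → MvPolynomial σ K}

theorem exists_sub_linear_mem_idealOfVars_sq (hY : ∀ u, constantCoeff (Y u) = 0)
    (hdet : (jacobianMatrix Y).det ≠ 0) {f : MvPolynomial σ K} (hf : f ∈ idealOfVars σ K) :
    ∃ a : σ → K, f - ∑ u, C (a u) * Y u ∈ idealOfVars σ K ^ 2 := by
  let gradient : σ → K := fun v => coeff (Finsupp.single v 1) f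
  let a := Matrix.vecMul gradient (jacobianMatrix Y)⁻¹
  have ha : Matrix.vecMul a (jacobianMatrix Y) = gradient := by
    rw [Matrix.vecMul_vecMul, Matrix.nonsing_inv_mul _ hdet.isUnit, Matrix.vecMul_one]
  refine ⟨a, mem_idealOfVars_sq_iff.2 ⟨sub_mem hf (Ideal.sum_mem _ fun u _ =>
    Ideal.mul_mem_left _ _ (mem_idealOfVars_iff.2 (hY u))), fun v => ?_⟩⟩
  rw [coeff_sub, coeff_sum, sub_eq_zero]
  refine (congr_fun ha v).symm.trans ?_
  simp [Matrix.vecMul, dotProduct, jacobianMatrix, coeff_C_mul]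

theorem exists_mem_range_aeval_sub_mem_pow_succ (hY : ∀ u, constantCoeff (Y u) = 0)
    (hdet : (jacobianMatrix Y).det ≠ 0) (k : ℕ) {f : MvPolynomial σ K}
    (hf : f ∈ idealOfVars σ K ^ k) :
    ∃ b ∈ (aeval Y : MvPolynomial σ K →ₐ[K] MvPolynomial σ K).range,
      f - b ∈ idealOfVars σ K ^ (k + 1) := by
  induction k generalizing f with
  | zero =>
    refine ⟨C (constantCoeff f), Subalgebra.algebraMap_mem _ _, ?_⟩
    simp [mem_idealOfVars_iff]
  | succ k ih =>
    rw [pow_succ] at hf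
    induction hf using Submodule.mul_induction_on' with
    | mem_mul_mem g hg x hx =>
      obtain ⟨b, hb, hgb⟩ := ih hg
      obtain ⟨a, ha⟩ := exists_sub_linear_mem_idealOfVars_sq hY hdet hx
      set l := ∑ u, C (a u) * Y u
      refine ⟨b * l, mul_mem hb (sum_mem fun u _ => mul_mem (Subalgebra.algebraMap_mem _ _)
        ⟨X u, aeval_X _ u⟩), ?_⟩
      have hl : l ∈ idealOfVars σ K := by
        simpa using sub_mem hx (Ideal.pow_le_self two_ne_zero ha)
      have h : g * x - b * l = g * (x - l) + (g - b) * l := by ring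
      rw [h]
      refine add_mem ?_ ?_
      · exact pow_add (idealOfVars σ K) k 2 ▸ Ideal.mul_mem_mul hg ha
      · exact pow_succ (idealOfVars σ K) (k + 1) ▸ Ideal.mul_mem_mul hgb hl
    | add f _ g _ hf hg =>
      obtain ⟨b, hb, hfb⟩ := hf
      obtain ⟨b', hb', hgb⟩ := hg
      exact ⟨b + b', add_mem hb hb', add_sub_add_comm f g b b' ▸ add_mem hfb hgb⟩

theorem exists_sub_aeval_mem_pow (hY : ∀ u, constantCoeff (Y u) = 0)
    (hdet : (jacobianMatrix Y).det ≠ 0) (k : ℕ) (f : MvPolynomial σ K) :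
    ∃ g : MvPolynomial σ K, f - aeval Y g ∈ idealOfVars σ K ^ k := by
  induction k with
  | zero => exact ⟨0, by simp⟩
  | succ k ih =>
    obtain ⟨g, hg⟩ := ih
    obtain ⟨_, ⟨g', rfl⟩, hg'⟩ := exists_mem_range_aeval_sub_mem_pow_succ hY hdet k hg
    exact ⟨g + g', by rwa [map_add, ← sub_sub]⟩

theorem injective_of_surjective_of_isNoetherianRing {B : Type*} [CommRing B] [IsNoetherianRing B]
    {f : B →+* B} (hf : Function.Surjective f) : Function.Injective f := by
  let ker : ℕ →o Ideal B :=
    ⟨fun n => RingHom.ker (f ^ n), monotone_nat_of_le_succ fun n x hx => by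
      rw [RingHom.mem_ker] at hx ⊢
      rw [pow_succ', RingHom.mul_def, RingHom.comp_apply, hx, map_zero]⟩
  obtain ⟨n, hn⟩ := monotone_stabilizes_iff_noetherian.2 ‹_› ker
  refine (injective_iff_map_eq_zero f).2 fun x hx => ?_
  obtain ⟨y, rfl⟩ : ∃ y, (f ^ n) y = x := by
    rw [RingHom.coe_pow]
    exact hf.iterate n x
  have hy : y ∈ ker (n + 1) := by
    rwa [← RingHom.comp_apply, ← RingHom.mul_def, ← pow_succ'] at hx
  rw [← hn _ n.le_succ] at hy
  exact hy

variable {p : ℕ} [Fact p.Prime] [CharP K p]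

theorem aeval_mem_varPowIdeal_iff (hY : ∀ u, constantCoeff (Y u) = 0)
    (hdet : (jacobianMatrix Y).det ≠ 0) (e : ℕ) {f : MvPolynomial σ K} :
    aeval Y f ∈ varPowIdeal σ K (p ^ e) ↔ f ∈ varPowIdeal σ K (p ^ e) := by
  refine ⟨fun hf => ?_, fun hf => varPowIdeal_le_comap_aeval hY e hf⟩
  let J := varPowIdeal σ K (p ^ e)
  let θ : MvPolynomial σ K ⧸ J →+* MvPolynomial σ K ⧸ J :=
    Ideal.quotientMap J (aeval (R := K) Y).toRingHom (varPowIdeal_le_comap_aeval hY e)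
  have surjective_θ : Function.Surjective θ := fun a => by
    obtain ⟨f, rfl⟩ := Ideal.Quotient.mk_surjective a
    obtain ⟨N, hN⟩ := exists_idealOfVars_pow_le_varPowIdeal (σ := σ) (K := K) (p ^ e)
    obtain ⟨g, hg⟩ := exists_sub_aeval_mem_pow hY hdet N f
    exact ⟨Ideal.Quotient.mk J g, (Ideal.Quotient.eq.2 (hN hg)).symm⟩
  refine Ideal.Quotient.eq_zero_iff_mem.1
    (injective_of_surjective_of_isNoetherianRing surjective_θ ?_)
  rw [map_zero]
  exact Ideal.Quotient.eq_zero_iff_mem.2 hf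

theorem prod_pow_mul_mem_varPowIdeal_iff (hY : ∀ u, constantCoeff (Y u) = 0)
    (hdet : (jacobianMatrix Y).det ≠ 0) (e : ℕ) {s : Finset σ} {f : MvPolynomial σ K} :
    (∏ v ∈ s, Y v) ^ (p ^ e - 1) * f ∈ varPowIdeal σ K (p ^ e) ↔
      f ∈ varPowIdeal σ K (p ^ e) ⊔ Ideal.span (Y '' s) := by
  refine ⟨fun hf => ?_, fun hf => ?_⟩
  · obtain ⟨N, hN⟩ := exists_idealOfVars_pow_le_varPowIdeal (σ := σ) (K := K) (p ^ e)
    obtain ⟨g, hg⟩ := exists_sub_aeval_mem_pow hY hdet N f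
    have hfg := hN hg
    have aeval_mem : aeval Y ((∏ v ∈ s, X v) ^ (p ^ e - 1) * g) ∈ varPowIdeal σ K (p ^ e) := by
      simpa [mul_sub] using sub_mem hf (Ideal.mul_mem_left _ ((∏ v ∈ s, Y v) ^ (p ^ e - 1)) hfg)
    have hmap := Ideal.mem_map_of_mem (aeval (R := K) Y) <|
      mem_sup_of_prod_X_pow_mul_mem ((aeval_mem_varPowIdeal_iff hY hdet e).1 aeval_mem)
    rw [Ideal.map_sup, Ideal.map_span, ← Set.image_comp] at hmap
    simp only [Function.comp_def, aeval_X] at hmap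
    exact sub_add_cancel f (aeval Y g) ▸ add_mem (Ideal.mem_sup_left hfg)
      (sup_le_sup_right (Ideal.map_le_iff_le_comap.2 (varPowIdeal_le_comap_aeval hY e)) _ hmap)
  · rw [varPowIdeal_eq_frobeniusPower] at hf ⊢
    exact prod_pow_mul_mem_frobeniusPower (NeZero.ne _)
      (fun v _ => mem_idealOfVars_iff.2 (hY v)) hf

end Coordinates

section Approximation

theorem exists_notMem_sup_frobeniusPower {A : Type*} [CommRing A] [IsLocalRing A]
    [IsNoetherianRing A] (p : ℕ) [Fact p.Prime] {I : Ideal A} {z : A} (hz : z ∉ I) :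
    ∃ e, z ∉ I ⊔ frobeniusPower (maximalIdeal A) (p ^ e) := by
  by_contra! h
  have mem_iInf : z • (1 : A ⧸ I) ∈ ⨅ i, maximalIdeal A ^ i • (⊤ : Submodule A (A ⧸ I)) := by
    refine Submodule.mem_iInf _ |>.2 fun i => ?_
    obtain ⟨u, hu, w, hw, rfl⟩ := Submodule.mem_sup.1 (h i)
    have hu0 : u • (1 : A ⧸ I) = 0 := by
      rwa [Algebra.smul_def, mul_one, Ideal.Quotient.algebraMap_eq, Ideal.Quotient.eq_zero_iff_mem]
    have hle : frobeniusPower (maximalIdeal A) (p ^ i) ≤ maximalIdeal A ^ i :=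
      (frobeniusPower_le_pow _ _).trans
        (Ideal.pow_le_pow_right (Nat.lt_pow_self (Fact.out : p.Prime).one_lt).le)
    rw [add_smul, hu0, zero_add]
    exact Submodule.smul_mem_smul (hle hw) Submodule.mem_top
  rw [Ideal.iInf_pow_smul_eq_bot_of_isLocalRing _ (maximalIdeal.isMaximal A).ne_top,
    Submodule.mem_bot, Algebra.smul_def, mul_one, Ideal.Quotient.algebraMap_eq,
    Ideal.Quotient.eq_zero_iff_mem] at mem_iInf
  exact hz mem_iInf

variable {A B : Type*} [CommRing A] [CommRing B] {θ : B →+* A} {M : Ideal A}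

theorem exists_mem_sub_mem_of_mem_map_sup (hθ : ∀ a, ∃ g, a - θ g ∈ M) {J : Ideal B} {x : A}
    (hx : x ∈ J.map θ ⊔ M) : ∃ v ∈ J, x - θ v ∈ M := by
  have surjective : Function.Surjective ((Ideal.Quotient.mk M).comp θ) := fun a => by
    obtain ⟨a, rfl⟩ := Ideal.Quotient.mk_surjective a
    obtain ⟨g, hg⟩ := hθ a
    exact ⟨g, (Ideal.Quotient.eq.2 hg).symm⟩
  have hmk : Ideal.Quotient.mk M x ∈ J.map ((Ideal.Quotient.mk M).comp θ) := by
    rw [← Ideal.map_map]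
    simpa [Ideal.map_sup] using Ideal.mem_map_of_mem (Ideal.Quotient.mk M) hx
  obtain ⟨v, hv, hvx⟩ := (Ideal.mem_map_iff_of_surjective _ surjective).1 hmk
  exact ⟨v, hv, Ideal.Quotient.eq.1 hvx.symm⟩

theorem frobeniusPower_le_map_sup {p : ℕ} [Fact p.Prime] [CharP A p] (hθ : ∀ a, ∃ g, a - θ g ∈ M)
    (I : Ideal A) (e : ℕ) :
    frobeniusPower I (p ^ e) ≤
      (frobeniusPower ((I ⊔ M).comap θ) (p ^ e)).map θ ⊔ frobeniusPower M (p ^ e) := by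
  refine Ideal.span_le.2 ?_
  rintro _ ⟨u, hu, rfl⟩
  obtain ⟨g, hg⟩ := hθ u
  have hgI : g ∈ (I ⊔ M).comap θ := by
    simpa using sub_mem (Ideal.mem_sup_left hu) (Ideal.mem_sup_right (S := I) hg)
  have hsplit : u ^ p ^ e = θ (g ^ p ^ e) + (u - θ g) ^ p ^ e := by
    rw [sub_pow_char_pow, map_pow, add_sub_cancel]
  simp only [SetLike.mem_coe, hsplit]
  exact add_mem (Ideal.mem_sup_left (Ideal.mem_map_of_mem θ (pow_mem_frobeniusPower hgI _)))
    (Ideal.mem_sup_right (pow_mem_frobeniusPower hg _))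

theorem exists_map_mul_pow_sub_mem {p : ℕ} [Fact p.Prime] [CharP A p] {e : ℕ}
    (hθ : ∀ a, ∃ g, a - θ g ∈ M) (hθe : ∀ a, ∃ g, a - θ g ∈ frobeniusPower M (p ^ e)) {I : Ideal A}
    {c z : A} (hcz : c * z ^ p ^ e ∈ frobeniusPower I (p ^ e)) {c' z' : B}
    (hc : c - θ c' ∈ frobeniusPower M (p ^ e)) (hz : z - θ z' ∈ M) :
    ∃ v ∈ frobeniusPower ((I ⊔ M).comap θ) (p ^ e),
      θ (c' * z' ^ p ^ e - v) ∈ frobeniusPower M (p ^ e) := by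
  have hsub : c * z ^ p ^ e - θ (c' * z' ^ p ^ e) ∈ frobeniusPower M (p ^ e) := by
    have hz_pow := pow_mem_frobeniusPower hz (p ^ e)
    rw [sub_pow_char_pow] at hz_pow
    convert add_mem (Ideal.mul_mem_right (z ^ p ^ e) _ hc) (Ideal.mul_mem_left _ (θ c') hz_pow)
      using 1
    rw [map_mul, map_pow]
    ring
  simp only [map_sub]
  refine exists_mem_sub_mem_of_mem_map_sup hθe ?_
  rw [← sub_sub_cancel (c * z ^ p ^ e) (θ (c' * z' ^ p ^ e))]
  exact sub_mem (frobeniusPower_le_map_sup hθ I e hcz) (Ideal.mem_sup_right hsub)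

end Approximation

theorem span_range_pow_le_iff {ι B : Type*} [Fintype ι] [CommRing B] (g : ι → B) (r : ℕ)
    (I : Ideal B) :
    Ideal.span (Set.range g) ^ r ≤ I ↔ ∀ i : ι → ℕ, ∑ j, i j = r → ∏ j, g j ^ i j ∈ I := by
  have hmap : Ideal.span (Set.range g) = (idealOfVars ι B).map (eval g) := by
    rw [idealOfVars, Ideal.map_span, ← Set.range_comp]
    simp [Function.comp_def]
  rw [hmap, ← Ideal.map_pow, pow_idealOfVars_eq_span, Ideal.map_span, Ideal.span_le]
  simp only [← Set.image_comp, Set.image_subset_iff]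
  refine (Finsupp.equivFunOnFinite (α := ι) (M := ℕ)).forall_congr fun i => ?_
  simp [Finsupp.degree_eq_sum, eval_monomial, Finsupp.prod_fintype]

section Chart

variable {σ K A : Type*} [Fintype σ] [DecidableEq σ] [Field K]
  [CommRing A] [IsLocalRing A] {p : ℕ} {θ : MvPolynomial σ K →+* A}
  {Y : σ → MvPolynomial σ K} {s : Finset σ}

/-- The family `Y` is a system of coordinates at the origin and, up to each Frobenius power of the
maximal ideal, `θ` presents `A` as the quotient by the coordinates `Y v` with `v ∈ s`. -/
structure IsChart (p : ℕ) (θ : MvPolynomial σ K →+* A) (Y : σ → MvPolynomial σ K)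
    (s : Finset σ) : Prop where
  constantCoeff_eq_zero (u : σ) : constantCoeff (Y u) = 0
  det_ne_zero : (jacobianMatrix Y).det ≠ 0
  exists_sub_mem (e : ℕ) (a : A) : ∃ g, a - θ g ∈ frobeniusPower (maximalIdeal A) (p ^ e)
  mem_iff (e : ℕ) (g : MvPolynomial σ K) : θ g ∈ frobeniusPower (maximalIdeal A) (p ^ e) ↔
    g ∈ varPowIdeal σ K (p ^ e) ⊔ Ideal.span (Y '' s)

namespace IsChart

variable [Fact p.Prime] [CharP K p]

theorem prod_pow_mul_mem_iff (h : IsChart p θ Y s) (e : ℕ) (g : MvPolynomial σ K) :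
    (∏ v ∈ s, Y v) ^ (p ^ e - 1) * g ∈ varPowIdeal σ K (p ^ e) ↔
      θ g ∈ frobeniusPower (maximalIdeal A) (p ^ e) := by
  rw [prod_pow_mul_mem_varPowIdeal_iff h.constantCoeff_eq_zero h.det_ne_zero, h.mem_iff]

theorem prod_pow_mul_mem_frobeniusPower_comap (h : IsChart p θ Y s) (I : Ideal A) (N e : ℕ)
    {g : MvPolynomial σ K} (hg : θ g ∈ frobeniusPower (maximalIdeal A) (p ^ (N + e))) :
    (∏ v ∈ s, Y v) ^ (p ^ e - 1) * g ∈
      frobeniusPower ((I ⊔ frobeniusPower (maximalIdeal A) (p ^ N)).comap θ) (p ^ e) := by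
  have sup_le : varPowIdeal σ K (p ^ N) ⊔ Ideal.span (Y '' s) ≤
      (I ⊔ frobeniusPower (maximalIdeal A) (p ^ N)).comap θ :=
    fun g hg => Ideal.mem_sup_right ((h.mem_iff N g).2 hg)
  refine prod_pow_mul_mem_frobeniusPower (NeZero.ne _) (fun v hv =>
    sup_le (Ideal.mem_sup_right (Ideal.subset_span ⟨v, hv, rfl⟩))) ?_
  suffices hle : varPowIdeal σ K (p ^ (N + e)) ≤ frobeniusPower _ (p ^ e) from
    sup_le_sup_right hle _ ((h.mem_iff _ g).1 hg)
  rw [varPowIdeal_eq_frobeniusPower, ← frobeniusPower_frobeniusPower,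
    ← varPowIdeal_eq_frobeniusPower]
  exact frobeniusPower_mono (le_sup_left.trans sup_le) _

theorem hasFrobeniusColon [CharP A p] [IsNoetherianRing A] (h : IsChart p θ Y s) :
    HasFrobeniusColon A p := by
  intro I z hz e c hcz
  obtain ⟨N, hN⟩ := exists_notMem_sup_frobeniusPower p hz
  set M := frobeniusPower (maximalIdeal A) (p ^ N) with hM
  set I' := (I ⊔ M).comap θ
  set y := ∏ v ∈ s, Y v
  obtain ⟨z', hz'⟩ := h.exists_sub_mem N z
  obtain ⟨c', hc'⟩ := h.exists_sub_mem (N + e) c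
  have hz'I : z' ∉ I' := fun hmem => hN (by simpa using add_mem (Ideal.mem_sup_right hz') hmem)
  obtain ⟨N', hN'⟩ := exists_idealOfVars_pow_le_varPowIdeal (σ := σ) (K := K) (p ^ N)
  have pow_le : idealOfVars σ K ^ N' ≤ I' := fun g hg =>
    Ideal.mem_sup_right ((h.mem_iff N g).2 (Ideal.mem_sup_left (hN' hg)))
  obtain ⟨v, hv, hθv⟩ := exists_map_mul_pow_sub_mem (M := M) (h.exists_sub_mem N)
    (by simpa only [hM, frobeniusPower_frobeniusPower] using h.exists_sub_mem (N + e)) hcz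
    (by rwa [hM, frobeniusPower_frobeniusPower]) hz'
  rw [hM, frobeniusPower_frobeniusPower] at hθv
  have key : y ^ (p ^ e - 1) * c' * z' ^ p ^ e ∈ frobeniusPower I' (p ^ e) := by
    rw [mul_assoc, ← sub_add_cancel (c' * z' ^ p ^ e) v, mul_add]
    exact add_mem (h.prod_pow_mul_mem_frobeniusPower_comap I N e hθv) (Ideal.mul_mem_left _ _ hv)
  have hθc' := (h.prod_pow_mul_mem_iff e c').1 (mem_varPowIdeal_of_mul_pow_mem pow_le hz'I key)
  have hc : c - θ c' ∈ frobeniusPower (maximalIdeal A) (p ^ e) := by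
    rw [add_comm, ← frobeniusPower_frobeniusPower] at hc'
    exact frobeniusPower_le_self _ (NeZero.ne _) hc'
  simpa using add_mem hc hθc'

theorem noncontainmentValues_eq {ι : Type*} [Fintype ι] (h : IsChart p θ Y s)
    {f : ι → MvPolynomial σ K} (hf : ∀ j, constantCoeff (f j) = 0) :
    noncontainmentValues p (Ideal.span (Set.range fun j => θ (f j))) =
      mixedValues p (∏ v ∈ s, Y v) f := by
  classical
  have prod_mem_iff (e) (i : ι → ℕ) :
      ∏ j, θ (f j) ^ i j ∈ frobeniusPower (maximalIdeal A) (p ^ e) ↔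
        mixedPower p (∏ v ∈ s, Y v) f e i ∈ varPowIdeal σ K (p ^ e) := by
    rw [mixedPower, h.prod_pow_mul_mem_iff, map_prod]
    simp only [map_pow]
  ext x
  constructor
  · rintro ⟨e, r, hr, rfl⟩
    simp only [span_range_pow_le_iff, prod_mem_iff, not_forall] at hr
    obtain ⟨i, rfl, hi⟩ := hr
    have hlt (j) : i j < p ^ e := by
      by_contra! hle
      refine hi (Ideal.mul_mem_left _ _ ?_)
      refine Ideal.mem_of_dvd _ (Finset.dvd_prod_of_mem _ (Finset.mem_univ j)) ?_
      exact Ideal.mem_of_dvd _ (pow_dvd_pow _ hle) (pow_mem_varPowIdeal (hf j) e)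
    simp only [mem_varPowIdeal_iff, not_forall] at hi
    obtain ⟨γ, hγ, hne⟩ := hi
    exact ⟨e, i, γ, hlt, hγ, hne, rfl⟩
  · rintro ⟨e, i, γ, -, hγ, hne, rfl⟩
    refine ⟨e, _, fun hle => hne ?_, rfl⟩
    exact mem_varPowIdeal_iff.1 ((prod_mem_iff e i).1 ((span_range_pow_le_iff _ _ _).1 hle i rfl))
      γ hγ

end IsChart

end Chart

section LocalRing

variable {R : Type*} [CommRing R] [IsLocalRing R]

theorem isLocalRing_quotient {I : Ideal R} (hI : I ≤ maximalIdeal R) :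
    IsLocalRing (R ⧸ I) :=
  have := Ideal.Quotient.nontrivial_iff.2 fun h => (maximalIdeal.isMaximal R).ne_top
    (top_le_iff.1 (h ▸ hI))
  IsLocalRing.of_surjective' (Ideal.Quotient.mk I) Ideal.Quotient.mk_surjective

theorem exists_span_insert_erase_eq_maximalIdeal [DecidableEq R] {t : Finset R}
    (ht : Ideal.span (t : Set R) = maximalIdeal R) {x : R} (hx : x ∈ maximalIdeal R)
    (hx2 : x ∉ maximalIdeal R ^ 2) :
    ∃ i ∈ t, Ideal.span (insert x (t.erase i) : Finset R) = maximalIdeal R := by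
  obtain ⟨a, ha⟩ := Submodule.mem_span_finset'.1 (ht ▸ hx)
  obtain ⟨i, hi⟩ : ∃ i : t, IsUnit (a i) := by
    by_contra! hcon
    refine hx2 ?_
    rw [← ha, pow_two]
    exact Ideal.sum_mem _ fun i _ =>
      Ideal.mul_mem_mul ((mem_maximalIdeal _).2 (hcon i)) (ht ▸ Ideal.subset_span i.2)
  refine ⟨i, i.2, le_antisymm (Ideal.span_le.2 ?_) (ht ▸ Ideal.span_le.2 ?_)⟩
  · rintro y hy
    rcases Finset.mem_insert.1 hy with rfl | hy
    exacts [hx, ht ▸ Ideal.subset_span (Finset.mem_of_mem_erase hy)]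
  · rintro y hy
    by_cases hyi : y = i
    · rw [hyi, SetLike.mem_coe, ← Ideal.unit_mul_mem_iff_mem _ hi]
      have hsum : a i * i = x - ∑ k ∈ Finset.univ.erase i, a k * k := by
        rw [eq_sub_iff_add_eq, ← ha,
          Finset.add_sum_erase Finset.univ (fun k => a k * k) (Finset.mem_univ i)]
        rfl
      rw [hsum]
      refine sub_mem (Ideal.subset_span (Finset.mem_insert_self _ _)) (Ideal.sum_mem _ fun k hk =>
        Ideal.mul_mem_left _ _ (Ideal.subset_span (Finset.mem_insert_of_mem ?_)))
      exact Finset.mem_erase.2 ⟨fun h => Finset.ne_of_mem_erase hk (Subtype.ext h), k.2⟩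
    · exact Ideal.subset_span (Finset.mem_insert_of_mem (Finset.mem_erase.2 ⟨hyi, hy⟩))

theorem spanFinrank_maximalIdeal_quotient_span_singleton_lt [IsNoetherianRing R] {x : R}
    (hx : x ∈ maximalIdeal R) (hx2 : x ∉ maximalIdeal R ^ 2)
    [IsLocalRing (R ⧸ Ideal.span {x})] :
    (maximalIdeal (R ⧸ Ideal.span {x})).spanFinrank < (maximalIdeal R).spanFinrank := by
  classical
  obtain ⟨t, htcard, ht⟩ :=
    (IsNoetherian.noetherian (maximalIdeal R)).exists_span_finset_card_eq_spanFinrank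
  obtain ⟨i, hi, hspan⟩ := exists_span_insert_erase_eq_maximalIdeal ht hx hx2
  have hmap : maximalIdeal (R ⧸ Ideal.span {x}) =
      Ideal.span ((t.erase i).image (Ideal.Quotient.mk (Ideal.span {x})) : Finset _) := by
    rw [← map_maximalIdeal_of_surjective (Ideal.Quotient.mk _) Ideal.Quotient.mk_surjective,
      ← hspan, Ideal.map_span, Finset.coe_insert, Set.image_insert_eq, Finset.coe_image,
      Ideal.Quotient.eq_zero_iff_mem.2 (Ideal.mem_span_singleton_self x), Ideal.span_insert_zero]
  rw [hmap, ← htcard, ← Finset.card_erase_add_one hi, Nat.lt_succ_iff]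
  refine (Submodule.spanFinrank_span_le_ncard_of_finite (Finset.finite_toSet _)).trans ?_
  exact (Set.ncard_coe_finset _).trans_le Finset.card_image_le

theorem exists_mem_maximalIdeal_notMem_sq_notMem_minimalPrimes
    [IsNoetherianRing R] (hdim : ¬ Ring.KrullDimLE 0 R) :
    ∃ x ∈ maximalIdeal R, x ∉ maximalIdeal R ^ 2 ∧ ∀ P ∈ minimalPrimes R, x ∉ P := by
  by_contra! hcon
  have hsub : (maximalIdeal R : Set R) ⊆
      ⋃ I ∈ insert (maximalIdeal R ^ 2) (minimalPrimes R), (I : Set R) := fun x hx => by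
    by_cases h2 : x ∈ maximalIdeal R ^ 2
    · exact Set.mem_biUnion (Set.mem_insert _ _) h2
    · obtain ⟨P, hP, hxP⟩ := hcon x hx h2
      exact Set.mem_biUnion (Set.mem_insert_of_mem _ hP) hxP
  obtain ⟨I, hI, hle⟩ := (Ideal.subset_union_prime_finite
    ((minimalPrimes.finite_of_isNoetherianRing R).insert (maximalIdeal R ^ 2))
    (f := id) (maximalIdeal R ^ 2) (maximalIdeal R ^ 2)
    fun I hI hne _ => (Set.mem_of_mem_insert_of_ne hI hne).1.1).1 hsub
  refine hdim (Ring.krullDimLE_zero_iff.2 fun J hJ => ?_)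
  suffices h : maximalIdeal R ≤ J from
    le_antisymm (le_maximalIdeal hJ.ne_top) h ▸ maximalIdeal.isMaximal R
  rcases Set.mem_insert_iff.1 hI with rfl | hI
  · have hbot : maximalIdeal R = ⊥ :=
      Submodule.eq_bot_of_le_smul_of_le_jacobson_bot (maximalIdeal R) _
        (IsNoetherian.noetherian _) (by rwa [smul_eq_mul, ← pow_two])
        (maximalIdeal_le_jacobson _)
    exact hbot ▸ bot_le
  · exact hle.trans (hI.2 ⟨hJ, bot_le⟩ ((le_maximalIdeal hJ.ne_top).trans hle))

theorem isDomain_of_isPrime_span_singleton [IsNoetherianRing R] {x : R} (hx : x ∈ maximalIdeal R)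
    (hprime : (Ideal.span {x}).IsPrime) (hmin : ∀ P ∈ minimalPrimes R, x ∉ P) : IsDomain R := by
  obtain ⟨P, hP, hPx⟩ := Ideal.exists_minimalPrimes_le (I := ⊥) (J := Ideal.span {x}) bot_le
  have hPprime : P.IsPrime := hP.1.1
  have hbot : P = ⊥ := by
    refine Submodule.eq_bot_of_le_smul_of_le_jacobson_bot (maximalIdeal R) _
      (IsNoetherian.noetherian _) (fun z hz => ?_) (maximalIdeal_le_jacobson _)
    obtain ⟨y, rfl⟩ := Ideal.mem_span_singleton'.1 (hPx hz)
    have hy : y ∈ P := (hPprime.mem_or_mem hz).resolve_right (hmin P hP)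
    rw [mul_comm]
    exact Ideal.mul_mem_mul hx hy
  rw [hbot] at hPprime
  exact IsDomain.of_bot_isPrime R

end LocalRing

section RegularLocalRing

universe u

variable {A : Type u} [CommRing A] [IsRegularLocalRing A]

theorem isRegularLocalRing_quotient_span_singleton {x : A}
    (hx : x ∈ maximalIdeal A) (hx2 : x ∉ maximalIdeal A ^ 2) :
    IsRegularLocalRing (A ⧸ Ideal.span {x}) := by
  have hle : Ideal.span {x} ≤ maximalIdeal A := (Ideal.span_singleton_le_iff_mem _).2 hx
  have := isLocalRing_quotient hle
  refine .of_spanFinrank_maximalIdeal_le _ ?_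
  have hlt := spanFinrank_maximalIdeal_quotient_span_singleton_lt hx hx2
  have hdim := ringKrullDim_le_ringKrullDim_quotient_add_card {x} (by
    rw [ringJacobson_eq_maximalIdeal, Finset.coe_singleton, Set.singleton_subset_iff]
    exact hx)
  rw [Finset.coe_singleton, Finset.card_singleton,
    ← IsRegularLocalRing.spanFinrank_maximalIdeal] at hdim
  refine (ENat.WithBot.add_le_add_natCast_right_iff (c := 1)).1 (le_trans ?_ hdim)
  exact_mod_cast hlt

variable (A) in
theorem isDomain_of_isRegularLocalRing : IsDomain A := by
  induction hn : (maximalIdeal A).spanFinrank using Nat.strong_induction_on generalizing A with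
  | _ n ih =>
    by_cases hpos : Ring.KrullDimLE 0 A
    · have hbot : maximalIdeal A = ⊥ := by
        rw [← Submodule.spanFinrank_eq_zero_iff_eq_bot (IsNoetherian.noetherian _)]
        rw [ringKrullDimZero_iff_ringKrullDim_eq_zero,
          ← IsRegularLocalRing.spanFinrank_maximalIdeal] at hpos
        exact_mod_cast hpos
      exact (isField_iff_maximalIdeal_eq.2 hbot).isDomain
    · obtain ⟨x, hx, hx2, hmin⟩ := exists_mem_maximalIdeal_notMem_sq_notMem_minimalPrimes hpos
      have := isRegularLocalRing_quotient_span_singleton hx hx2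
      have hlt := spanFinrank_maximalIdeal_quotient_span_singleton_lt hx hx2
      exact isDomain_of_isPrime_span_singleton hx
        ((Ideal.Quotient.isDomain_iff_prime _).1 (ih _ (hn ▸ hlt) _ rfl)) hmin

end RegularLocalRing

theorem card_le_height_span_image {R σ : Type*} [CommRing R] {Y : σ → R}
    (hprime : ∀ s : Finset σ, (Ideal.span (Y '' s)).IsPrime)
    (hY : ∀ (s : Finset σ) (v : σ), v ∉ s → Y v ∉ Ideal.span (Y '' s)) (s : Finset σ) :
    (s.card : ℕ∞) ≤ (Ideal.span (Y '' s)).height := by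
  classical
  induction s using Finset.induction_on with
  | empty => simp
  | insert v s hv ih =>
    have := hprime s
    have := hprime (insert v s)
    have hlt : Ideal.span (Y '' s) < Ideal.span (Y '' (insert v s : Finset σ)) :=
      (Ideal.span_mono (Set.image_mono (Finset.coe_subset.2 (Finset.subset_insert v s)))).lt_of_ne
        fun heq => hY s v hv (heq ▸ Ideal.subset_span
          (Set.mem_image_of_mem Y (Finset.mem_coe.2 (Finset.mem_insert_self v s))))
    rw [Finset.card_insert_of_notMem hv, Nat.cast_add, Nat.cast_one]
    exact (add_le_add_left ih 1).trans (Ideal.height_add_one_le_of_lt_of_isPrime hlt)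

section Parameters

variable {R σ : Type*} [CommRing R] [IsLocalRing R] {Y : σ → R}

theorem spanFinrank_maximalIdeal_le_card [Fintype σ]
    (hY : Ideal.span (Set.range Y) = maximalIdeal R) :
    (maximalIdeal R).spanFinrank ≤ Fintype.card σ := by
  have h := Submodule.spanFinrank_span_le_ncard_of_finite (R := R) (Set.finite_range Y)
  rw [← hY]
  exact h.trans <| by
    rw [← Set.image_univ, ← Nat.card_eq_fintype_card, ← Set.ncard_univ]
    exact Set.ncard_image_le

theorem isRegularLocalRing_of_card_le_ringKrullDim [IsNoetherianRing R] [Fintype σ]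
    (hY : Ideal.span (Set.range Y) = maximalIdeal R)
    (hdim : (Fintype.card σ : WithBot ℕ∞) ≤ ringKrullDim R) : IsRegularLocalRing R :=
  .of_spanFinrank_maximalIdeal_le R <|
    (Nat.cast_le.2 (spanFinrank_maximalIdeal_le_card hY)).trans hdim

theorem span_range_mk_eq_maximalIdeal (hY : Ideal.span (Set.range Y) = maximalIdeal R)
    (s : Set σ) [IsLocalRing (R ⧸ Ideal.span (Y '' s))] :
    Ideal.span (Set.range fun v : {v // v ∉ s} => Ideal.Quotient.mk (Ideal.span (Y '' s)) (Y v)) =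
      maximalIdeal (R ⧸ Ideal.span (Y '' s)) := by
  rw [← map_maximalIdeal_of_surjective (Ideal.Quotient.mk _) Ideal.Quotient.mk_surjective, ← hY,
    Ideal.map_span]
  refine le_antisymm (Ideal.span_mono ?_) (Ideal.span_le.2 ?_)
  · rintro _ ⟨v, rfl⟩
    exact ⟨Y v, ⟨v, rfl⟩, rfl⟩
  · rintro _ ⟨_, ⟨v, rfl⟩, rfl⟩
    by_cases hv : v ∈ s
    · rw [Ideal.Quotient.eq_zero_iff_mem.2 (Ideal.subset_span (Set.mem_image_of_mem Y hv))]
      exact zero_mem _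
    · exact Ideal.subset_span ⟨⟨v, hv⟩, rfl⟩

variable [IsNoetherianRing R] [Fintype σ]

theorem le_ringKrullDim_quotient_span_image (hY : Ideal.span (Set.range Y) = maximalIdeal R)
    (hdim : (Fintype.card σ : WithBot ℕ∞) ≤ ringKrullDim R) (s : Finset σ) :
    ((Fintype.card σ - s.card : ℕ) : WithBot ℕ∞) ≤ ringKrullDim (R ⧸ Ideal.span (Y '' s)) := by
  classical
  have hmem : ((s.image Y : Finset R) : Set R) ⊆ Ring.jacobson R := by
    rw [ringJacobson_eq_maximalIdeal, ← hY, Finset.coe_image]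
    exact (Set.image_subset_range Y s).trans Ideal.subset_span
  have hle := ringKrullDim_le_ringKrullDim_quotient_add_card (s.image Y) hmem
  rw [Finset.coe_image] at hle
  refine (ENat.WithBot.add_le_add_natCast_right_iff (c := s.card)).1 ?_
  rw [← Nat.cast_add, Nat.sub_add_cancel s.card_le_univ]
  exact (hdim.trans hle).trans (add_le_add_right (Nat.cast_le.2 Finset.card_image_le) _)

theorem isRegularLocalRing_quotient_span_image
    (hY : Ideal.span (Set.range Y) = maximalIdeal R)
    (hdim : (Fintype.card σ : WithBot ℕ∞) ≤ ringKrullDim R) (s : Finset σ) :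
    IsRegularLocalRing (R ⧸ Ideal.span (Y '' s)) := by
  classical
  have := isLocalRing_quotient (hY ▸ Ideal.span_mono (Set.image_subset_range Y s))
  refine isRegularLocalRing_of_card_le_ringKrullDim (span_range_mk_eq_maximalIdeal hY s) ?_
  simpa [Fintype.card_subtype_compl] using le_ringKrullDim_quotient_span_image hY hdim s

theorem ringKrullDim_quotient_span_image_le (hY : Ideal.span (Set.range Y) = maximalIdeal R)
    (s : Finset σ) :
    ringKrullDim (R ⧸ Ideal.span (Y '' s)) ≤ (Fintype.card σ - s.card : ℕ) := by
  classical
  have := isLocalRing_quotient (hY ▸ Ideal.span_mono (Set.image_subset_range Y s))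
  refine (ringKrullDim_le_spanFinrank_maximalIdeal _).trans (Nat.cast_le.2 ?_)
  simpa [Fintype.card_subtype_compl] using
    spanFinrank_maximalIdeal_le_card (span_range_mk_eq_maximalIdeal hY s)

theorem isDomain_quotient_span_image (hY : Ideal.span (Set.range Y) = maximalIdeal R)
    (hdim : (Fintype.card σ : WithBot ℕ∞) ≤ ringKrullDim R) (s : Finset σ) :
    IsDomain (R ⧸ Ideal.span (Y '' s)) :=
  have := isRegularLocalRing_quotient_span_image hY hdim s
  isDomain_of_isRegularLocalRing _

theorem notMem_span_image (hY : Ideal.span (Set.range Y) = maximalIdeal R)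
    (hdim : (Fintype.card σ : WithBot ℕ∞) ≤ ringKrullDim R) (s : Finset σ) (v : σ) (hv : v ∉ s) :
    Y v ∉ Ideal.span (Y '' s) := fun hmem => by
  classical
  have heq : Ideal.span (Y '' (insert v s : Finset σ)) = Ideal.span (Y '' s) := by
    rw [Finset.coe_insert, Set.image_insert_eq, Ideal.span_insert, sup_eq_right]
    exact (Ideal.span_singleton_le_iff_mem _).2 hmem
  have hle := (le_ringKrullDim_quotient_span_image hY hdim s).trans
    (heq ▸ ringKrullDim_quotient_span_image_le hY (insert v s))
  have hcard := Finset.card_le_univ (insert v s)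
  rw [Nat.cast_le, Finset.card_insert_of_notMem hv] at hle
  rw [Finset.card_insert_of_notMem hv] at hcard
  omega

theorem card_le_height_span_image_parameters (hY : Ideal.span (Set.range Y) = maximalIdeal R)
    (hdim : (Fintype.card σ : WithBot ℕ∞) ≤ ringKrullDim R) (s : Finset σ) :
    (s.card : ℕ∞) ≤ (Ideal.span (Y '' s)).height :=
  card_le_height_span_image (fun t => (Ideal.Quotient.isDomain_iff_prime _).1
    (isDomain_quotient_span_image hY hdim t)) (notMem_span_image hY hdim) s

theorem ker_eq_span_image {A : Type*} [CommRing A]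
    (hY : Ideal.span (Set.range Y) = maximalIdeal R)
    (hdim : (Fintype.card σ : WithBot ℕ∞) ≤ ringKrullDim R) {s : Finset σ} {g : R →+* A}
    (hg : Function.Surjective g) (hgY : ∀ v ∈ s, g (Y v) = 0)
    (hA : ((Fintype.card σ - s.card : ℕ) : WithBot ℕ∞) ≤ ringKrullDim A) :
    RingHom.ker g = Ideal.span (Y '' s) := by
  have hle : Ideal.span (Y '' s) ≤ RingHom.ker g := by
    rw [Ideal.span_le]
    rintro _ ⟨v, hv, rfl⟩
    exact hgY v hv
  refine le_antisymm (fun r hr => ?_) hle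
  by_contra hrs
  have := isDomain_quotient_span_image hY hdim s
  have hlt := ringKrullDim_succ_le_of_surjective (Ideal.Quotient.lift _ g hle)
    (Ideal.Quotient.lift_surjective_of_surjective _ _ hg) (r := Ideal.Quotient.mk _ r)
    (mem_nonZeroDivisors_of_ne_zero fun h => hrs (Ideal.Quotient.eq_zero_iff_mem.1 h)) hr
  have hle' := (add_le_add_left hA 1).trans
    (hlt.trans (ringKrullDim_quotient_span_image_le hY s))
  exact absurd (Nat.cast_le.1 (by exact_mod_cast hle') :
    Fintype.card σ - s.card + 1 ≤ Fintype.card σ - s.card) (by omega)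

end Parameters

section PolynomialLocalization

variable {σ K : Type*} [Field K]

theorem isPrime_span_image_X (s : Finset σ) :
    (Ideal.span (X '' s) : Ideal (MvPolynomial σ K)).IsPrime := by
  classical
  set I : Ideal (MvPolynomial σ K) := Ideal.span (X '' s)
  set g : MvPolynomial σ K →ₐ[K] MvPolynomial σ K := aeval fun v => if v ∈ s then 0 else X v
  have hg : (Ideal.Quotient.mkₐ K I).comp g = Ideal.Quotient.mkₐ K I := by
    ext v
    by_cases hv : v ∈ s
    · have hX : Ideal.Quotient.mk I (X v) = 0 :=
        Ideal.Quotient.eq_zero_iff_mem.2 (Ideal.subset_span (Set.mem_image_of_mem X hv))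
      simp [g, hv, hX]
    · simp [g, hv]
  have hker : I = RingHom.ker g := by
    refine le_antisymm (Ideal.span_le.2 ?_) fun f hf => ?_
    · rintro _ ⟨v, hv, rfl⟩
      simp [g, Finset.mem_coe.1 hv]
    · rw [← Ideal.Quotient.eq_zero_iff_mem, ← Ideal.Quotient.mkₐ_eq_mk K, ← hg,
        AlgHom.comp_apply, RingHom.mem_ker.1 hf, map_zero]
  exact hker ▸ RingHom.ker_isPrime _

theorem X_notMem_span_image_X (s : Finset σ) (v : σ) (hv : v ∉ s) :
    (X v : MvPolynomial σ K) ∉ Ideal.span (X '' s) := fun h => by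
  obtain ⟨u, hu, hne⟩ := mem_ideal_span_X_image.1 h (Finsupp.single v 1) (by simp)
  exact hv (of_not_not (mt Finsupp.single_eq_of_ne hne) ▸ hu)

variable [Fintype σ]

variable (σ K) in
theorem card_le_ringKrullDim_localization :
    (Fintype.card σ : WithBot ℕ∞) ≤ ringKrullDim (Localization.AtPrime (idealOfVars σ K)) := by
  rw [IsLocalization.AtPrime.ringKrullDim_eq_height (idealOfVars σ K)]
  have h := card_le_height_span_image (isPrime_span_image_X (σ := σ) (K := K))
    X_notMem_span_image_X Finset.univ
  rw [Finset.coe_univ, Set.image_univ] at h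
  exact_mod_cast h

theorem span_range_eq_maximalIdeal_localization [DecidableEq σ] {Y : σ → MvPolynomial σ K}
    (hY : ∀ u, constantCoeff (Y u) = 0) (hdet : (jacobianMatrix Y).det ≠ 0) :
    Ideal.span (Set.range fun v => algebraMap _ (Localization.AtPrime (idealOfVars σ K)) (Y v)) =
      maximalIdeal (Localization.AtPrime (idealOfVars σ K)) := by
  set L := Localization.AtPrime (idealOfVars σ K)
  have hmax : (idealOfVars σ K).map (algebraMap _ L) = maximalIdeal L :=
    IsLocalization.AtPrime.map_eq_maximalIdeal _ _
  have hspan : Ideal.span (Set.range fun v => algebraMap _ L (Y v)) =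
      (Ideal.span (Set.range Y)).map (algebraMap _ L) := by
    rw [Ideal.map_span, ← Set.range_comp]
    rfl
  have hle : Ideal.span (Set.range Y) ≤ idealOfVars σ K :=
    Ideal.span_le.2 (Set.range_subset_iff.2 fun u => mem_idealOfVars_iff.2 (hY u))
  rw [hspan]
  refine le_antisymm (hmax ▸ Ideal.map_mono hle) ?_
  refine Submodule.le_of_le_smul_of_le_jacobson_bot (I := maximalIdeal L)
    (IsNoetherian.noetherian _) (maximalIdeal_le_jacobson _) ?_
  rw [smul_eq_mul, ← hmax, ← Ideal.map_mul, ← Ideal.map_sup, ← pow_two]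
  refine Ideal.map_mono fun f hf => ?_
  obtain ⟨a, ha⟩ := exists_sub_linear_mem_idealOfVars_sq hY hdet hf
  have hlin : ∑ u, C (a u) * Y u ∈ Ideal.span (Set.range Y) :=
    Ideal.sum_mem _ fun u _ => Ideal.mul_mem_left _ _ (Ideal.subset_span ⟨u, rfl⟩)
  simpa only [add_sub_cancel] using Submodule.add_mem_sup hlin ha

end PolynomialLocalization

theorem exists_mul_sub_one_mem_varPowIdeal {σ K : Type*} [Finite σ] [Field K] (q : ℕ)
    {u : MvPolynomial σ K} (hu : constantCoeff u ≠ 0) : ∃ u', u' * u - 1 ∈ varPowIdeal σ K q := by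
  obtain ⟨N, hN⟩ := exists_idealOfVars_pow_le_varPowIdeal (σ := σ) (K := K) q
  set J := varPowIdeal σ K q
  have isNilpotent : IsNilpotent (Ideal.Quotient.mk J (u - C (constantCoeff u))) := by
    refine ⟨N, ?_⟩
    rw [← map_pow, Ideal.Quotient.eq_zero_iff_mem]
    exact hN (Ideal.pow_mem_pow (mem_idealOfVars_iff.2 (by simp)) _)
  have isUnit_C : IsUnit (Ideal.Quotient.mk J (C (constantCoeff u))) :=
    ((isUnit_iff_ne_zero.2 hu).map C).map _
  have isUnit_mk := isNilpotent.isUnit_add_left_of_commute isUnit_C (Commute.all _ _)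
  rw [← map_add, add_sub_cancel] at isUnit_mk
  obtain ⟨b, hb⟩ := isUnit_mk.exists_left_inv
  obtain ⟨u', rfl⟩ := Ideal.Quotient.mk_surjective b
  refine ⟨u', ?_⟩
  rwa [← map_mul, ← map_one (Ideal.Quotient.mk J), Ideal.Quotient.eq] at hb

/-- The ring homomorphism `θ` presents the local ring `A` as a quotient of the localization of
`K[x]` at the origin. -/
structure IsLocalPresentation {σ K A : Type*} [Field K] [CommRing A]
    (θ : MvPolynomial σ K →+* A) : Prop where
  isUnit_iff (u : MvPolynomial σ K) : IsUnit (θ u) ↔ constantCoeff u ≠ 0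
  exists_mul_eq (a : A) : ∃ u g, constantCoeff u ≠ 0 ∧ θ u * a = θ g

namespace IsLocalPresentation

variable {σ K A : Type*} [Field K] [CommRing A] {θ : MvPolynomial σ K →+* A}

theorem constantCoeff_eq_zero_of_mul_eq [IsLocalRing A] (hθ : IsLocalPresentation θ) {a b : A}
    (ha : a ∈ maximalIdeal A) {g : MvPolynomial σ K} (hg : b * a = θ g) : constantCoeff g = 0 := by
  by_contra hne
  have isUnit := (hθ.isUnit_iff g).2 hne
  rw [← hg] at isUnit
  exact (mem_maximalIdeal _).1 ha (isUnit_of_mul_isUnit_right isUnit)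

theorem map_idealOfVars [IsLocalRing A] (hθ : IsLocalPresentation θ) :
    (idealOfVars σ K).map θ = maximalIdeal A := by
  refine le_antisymm (Ideal.map_le_iff_le_comap.2 fun u hu => ?_) fun a ha => ?_
  · refine (mem_maximalIdeal _).2 fun h => ?_
    exact (hθ.isUnit_iff u).1 h (mem_idealOfVars_iff.1 hu)
  · obtain ⟨u, g, hu, hg⟩ := hθ.exists_mul_eq a
    refine (Ideal.unit_mul_mem_iff_mem _ ((hθ.isUnit_iff u).2 hu)).1 ?_
    rw [hg]
    exact Ideal.mem_map_of_mem _
      (mem_idealOfVars_iff.2 (hθ.constantCoeff_eq_zero_of_mul_eq ha hg))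

theorem exists_mul_eq_of_mem_map (hθ : IsLocalPresentation θ) {J : Ideal (MvPolynomial σ K)} {a : A}
    (ha : a ∈ J.map θ) : ∃ u, constantCoeff u ≠ 0 ∧ ∃ j ∈ J, θ u * a = θ j := by
  induction ha using Submodule.span_induction with
  | mem x hx =>
    obtain ⟨j, hj, rfl⟩ := hx
    exact ⟨1, by simp, j, hj, by simp⟩
  | zero => exact ⟨1, by simp, 0, zero_mem _, by simp⟩
  | add x y _ _ hx hy =>
    obtain ⟨u, hu, j, hj, hxj⟩ := hx
    obtain ⟨v, hv, k, hk, hyk⟩ := hy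
    refine ⟨u * v, by simp [hu, hv], v * j + u * k,
      add_mem (Ideal.mul_mem_left _ _ hj) (Ideal.mul_mem_left _ _ hk), ?_⟩
    simp only [map_mul, map_add, ← hxj, ← hyk]
    ring
  | smul b x _ hx =>
    obtain ⟨u, hu, j, hj, hxj⟩ := hx
    obtain ⟨v, g, hv, hg⟩ := hθ.exists_mul_eq b
    refine ⟨u * v, by simp [hu, hv], g * j, Ideal.mul_mem_left _ _ hj, ?_⟩
    simp only [map_mul, smul_eq_mul, ← hxj, ← hg]
    ring

theorem map_varPowIdeal [IsLocalRing A] {p : ℕ} [Fact p.Prime] [CharP A p]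
    (hθ : IsLocalPresentation θ) (e : ℕ) :
    (varPowIdeal σ K (p ^ e)).map θ = frobeniusPower (maximalIdeal A) (p ^ e) := by
  rw [← hθ.map_idealOfVars, idealOfVars, Ideal.map_span, frobeniusPower_span, varPowIdeal,
    Ideal.map_span, Set.image_image, ← Set.range_comp, ← Set.range_comp]
  simp only [Function.comp_def, map_pow]

theorem exists_sub_mem_frobeniusPower [Finite σ] [IsLocalRing A] {p : ℕ} [Fact p.Prime] [CharP A p]
    (hθ : IsLocalPresentation θ) (e : ℕ) (a : A) :
    ∃ g, a - θ g ∈ frobeniusPower (maximalIdeal A) (p ^ e) := by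
  obtain ⟨u, g, hu, hg⟩ := hθ.exists_mul_eq a
  obtain ⟨u', hu'⟩ := exists_mul_sub_one_mem_varPowIdeal (p ^ e) hu
  have hsub : a - θ (u' * g) = -(θ (u' * u - 1) * a) := by
    rw [map_mul, ← hg, map_sub, map_mul, map_one]
    ring
  refine ⟨u' * g, ?_⟩
  rw [hsub, ← hθ.map_varPowIdeal]
  exact neg_mem (Ideal.mul_mem_right _ _ (Ideal.mem_map_of_mem _ hu'))

theorem ringKrullDim_le_quotient_ker (hθ : IsLocalPresentation θ) :
    ringKrullDim A ≤ ringKrullDim (MvPolynomial σ K ⧸ RingHom.ker θ) := by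
  refine Order.krullDim_le_of_strictMono (PrimeSpectrum.comap (RingHom.kerLift θ)) ?_
  intro P Q hPQ
  refine lt_of_le_not_ge (fun x hx => hPQ.le hx) fun hle => hPQ.not_ge fun a ha => ?_
  obtain ⟨u, g, hu, hg⟩ := hθ.exists_mul_eq a
  have hgQ : θ g ∈ Q.asIdeal := hg ▸ Ideal.mul_mem_left _ _ ha
  have hgP : θ g ∈ P.asIdeal :=
    hle (show Ideal.Quotient.mk _ g ∈ (PrimeSpectrum.comap (RingHom.kerLift θ) Q).asIdeal from hgQ)
  rw [← hg] at hgP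
  exact (Ideal.unit_mul_mem_iff_mem _ ((hθ.isUnit_iff u).2 hu)).1 hgP

section Localization

/-- The extension of a local presentation to the localization at the origin. -/
noncomputable def toLocalization (hθ : IsLocalPresentation θ) :
    Localization.AtPrime (idealOfVars σ K) →+* A :=
  IsLocalization.lift (M := (idealOfVars σ K).primeCompl) (g := θ) fun u =>
    (hθ.isUnit_iff u).2 fun h => u.2 (mem_idealOfVars_iff.2 h)

theorem toLocalization_algebraMap (hθ : IsLocalPresentation θ) (f : MvPolynomial σ K) :
    hθ.toLocalization (algebraMap _ _ f) = θ f :=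
  IsLocalization.lift_eq _ _

theorem toLocalization_surjective (hθ : IsLocalPresentation θ) :
    Function.Surjective hθ.toLocalization := fun a => by
  obtain ⟨u, g, hu, hg⟩ := hθ.exists_mul_eq a
  refine ⟨IsLocalization.mk' _ g (⟨u, fun h => hu (mem_idealOfVars_iff.1 h)⟩ :
    (idealOfVars σ K).primeCompl), ?_⟩
  rw [toLocalization, IsLocalization.lift_mk'_spec]
  exact hg.symm

theorem under_ker_toLocalization (hθ : IsLocalPresentation θ) :
    (RingHom.ker hθ.toLocalization).under (MvPolynomial σ K) = RingHom.ker θ := by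
  ext f
  rw [Ideal.under, Ideal.mem_comap, RingHom.mem_ker, toLocalization_algebraMap, RingHom.mem_ker]

theorem isNoetherianRing [Finite σ] (hθ : IsLocalPresentation θ) : IsNoetherianRing A :=
  isNoetherianRing_of_surjective _ _ hθ.toLocalization hθ.toLocalization_surjective

end Localization

section Coordinates

variable [Fintype σ] [DecidableEq σ] {Y : σ → MvPolynomial σ K} {s : Finset σ}

theorem ker_toLocalization (hθ : IsLocalPresentation θ) (hY : ∀ u, constantCoeff (Y u) = 0)
    (hdet : (jacobianMatrix Y).det ≠ 0) (hs : ∀ v ∈ s, θ (Y v) = 0)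
    (hA : ((Fintype.card σ - s.card : ℕ) : WithBot ℕ∞) ≤ ringKrullDim A) :
    RingHom.ker hθ.toLocalization = Ideal.span ((fun v => algebraMap _ _ (Y v)) '' s) :=
  ker_eq_span_image (span_range_eq_maximalIdeal_localization hY hdet)
    (card_le_ringKrullDim_localization σ K) hθ.toLocalization_surjective
    (fun v hv => by rw [toLocalization_algebraMap, hs v hv]) hA

theorem card_le_height_ker (hθ : IsLocalPresentation θ) (hY : ∀ u, constantCoeff (Y u) = 0)
    (hdet : (jacobianMatrix Y).det ≠ 0) (hs : ∀ v ∈ s, θ (Y v) = 0)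
    (hA : ((Fintype.card σ - s.card : ℕ) : WithBot ℕ∞) ≤ ringKrullDim A) :
    (s.card : ℕ∞) ≤ (RingHom.ker θ).height := by
  rw [← hθ.under_ker_toLocalization, IsLocalization.height_under (idealOfVars σ K).primeCompl,
    hθ.ker_toLocalization hY hdet hs hA]
  exact card_le_height_span_image_parameters (span_range_eq_maximalIdeal_localization hY hdet)
    (card_le_ringKrullDim_localization σ K) s

theorem exists_mul_mem_span (hθ : IsLocalPresentation θ) (hY : ∀ u, constantCoeff (Y u) = 0)
    (hdet : (jacobianMatrix Y).det ≠ 0) (hs : ∀ v ∈ s, θ (Y v) = 0)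
    (hA : ((Fintype.card σ - s.card : ℕ) : WithBot ℕ∞) ≤ ringKrullDim A)
    {g : MvPolynomial σ K} (hg : θ g = 0) :
    ∃ u, constantCoeff u ≠ 0 ∧ u * g ∈ Ideal.span (Y '' s) := by
  have hmap : algebraMap _ (Localization.AtPrime (idealOfVars σ K)) g ∈
      (Ideal.span (Y '' s)).map (algebraMap _ _) := by
    rw [Ideal.map_span, Set.image_image, ← hθ.ker_toLocalization hY hdet hs hA, RingHom.mem_ker,
      toLocalization_algebraMap, hg]
  obtain ⟨u, hu, hmem⟩ := (IsLocalization.algebraMap_mem_map_algebraMap_iff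
    (idealOfVars σ K).primeCompl _ _ _).1 hmap
  exact ⟨u, fun h => hu (mem_idealOfVars_iff.2 h), hmem⟩

variable [IsLocalRing A] {p : ℕ} [Fact p.Prime] [CharP A p]

theorem mem_frobeniusPower_iff (hθ : IsLocalPresentation θ) (hY : ∀ u, constantCoeff (Y u) = 0)
    (hdet : (jacobianMatrix Y).det ≠ 0) (hs : ∀ v ∈ s, θ (Y v) = 0)
    (hA : ((Fintype.card σ - s.card : ℕ) : WithBot ℕ∞) ≤ ringKrullDim A) (e : ℕ)
    (g : MvPolynomial σ K) : θ g ∈ frobeniusPower (maximalIdeal A) (p ^ e) ↔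
      g ∈ varPowIdeal σ K (p ^ e) ⊔ Ideal.span (Y '' s) := by
  rw [← hθ.map_varPowIdeal]
  constructor
  · intro hg
    obtain ⟨u, hu, j, hj, huj⟩ := hθ.exists_mul_eq_of_mem_map hg
    rw [← map_mul, ← sub_eq_zero, ← map_sub] at huj
    obtain ⟨v, hv, hmem⟩ := hθ.exists_mul_mem_span hY hdet hs hA huj
    obtain ⟨w, hw⟩ := exists_mul_sub_one_mem_varPowIdeal (u := v * u) (p ^ e) (by simp [hu, hv])
    have hsplit : g = w * (v * (u * g - j)) + (w * v) * j - (w * (v * u) - 1) * g := by ring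
    rw [hsplit]
    exact sub_mem (add_mem (Ideal.mem_sup_right (Ideal.mul_mem_left _ _ hmem))
      (Ideal.mem_sup_left (Ideal.mul_mem_left _ _ hj)))
      (Ideal.mem_sup_left (Ideal.mul_mem_right _ _ hw))
  · intro hg
    obtain ⟨a, ha, b, hb, rfl⟩ := Submodule.mem_sup.1 hg
    have span_le_ker : Ideal.span (Y '' s) ≤ RingHom.ker θ :=
      Ideal.span_le.2 (Set.image_subset_iff.2 hs)
    rw [map_add, RingHom.mem_ker.1 (span_le_ker hb), add_zero]
    exact Ideal.mem_map_of_mem _ ha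

theorem isChart (hθ : IsLocalPresentation θ) (hY : ∀ u, constantCoeff (Y u) = 0)
    (hdet : (jacobianMatrix Y).det ≠ 0) (hs : ∀ v ∈ s, θ (Y v) = 0)
    (hA : ((Fintype.card σ - s.card : ℕ) : WithBot ℕ∞) ≤ ringKrullDim A) : IsChart p θ Y s where
  constantCoeff_eq_zero := hY
  det_ne_zero := hdet
  exists_sub_mem := hθ.exists_sub_mem_frobeniusPower
  mem_iff := hθ.mem_frobeniusPower_iff hY hdet hs hA

theorem fpt_eq {ι : Type*} [Fintype ι] [CharP K p] (hθ : IsLocalPresentation θ)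
    (hY : ∀ u, constantCoeff (Y u) = 0)
    (hdet : (jacobianMatrix Y).det ≠ 0) (hs : ∀ v ∈ s, θ (Y v) = 0)
    (hA : ((Fintype.card σ - s.card : ℕ) : WithBot ℕ∞) ≤ ringKrullDim A)
    {f : ι → MvPolynomial σ K} (hf : ∀ j, constantCoeff (f j) = 0) {v : ℝ}
    (hv : IsLUB (mixedValues p (∏ v ∈ s, Y v) f) v) :
    fpt p (Ideal.span (Set.range fun j => θ (f j))) = ENNReal.ofReal v := by
  have := hθ.isNoetherianRing
  have chart : IsChart p θ Y s := hθ.isChart hY hdet hs hA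
  exact chart.hasFrobeniusColon.fpt_eq (chart.noncontainmentValues_eq hf ▸ hv)

end Coordinates

end IsLocalPresentation

section LinearPart

variable {σ K : Type*} [CommRing K]

variable (σ K) in
/-- The linear part of a polynomial, as the vector of its coefficients. -/
noncomputable def linearPart : MvPolynomial σ K →ₗ[K] σ → K :=
  LinearMap.pi fun v => lcoeff K (Finsupp.single v 1)

@[simp] theorem linearPart_apply (f : MvPolynomial σ K) (v : σ) :
    linearPart σ K f v = coeff (Finsupp.single v 1) f := rfl

theorem linearPart_mul (f g : MvPolynomial σ K) : linearPart σ K (f * g) =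
    constantCoeff f • linearPart σ K g + constantCoeff g • linearPart σ K f := by
  classical
  ext v
  rw [linearPart_apply, coeff_mul, Finsupp.antidiagonal_single]
  simp [Finset.Nat.antidiagonal_succ, constantCoeff_eq, mul_comm]

theorem linearPart_X [DecidableEq σ] (v : σ) :
    linearPart σ K (X v) = Pi.single v 1 := by
  ext w
  rw [linearPart_apply, coeff_X, Pi.single_apply]
  simp only [(Finsupp.single_left_injective one_ne_zero).eq_iff, eq_comm]

theorem linearPart_mem_span_image {T : Set (MvPolynomial σ K)} (hT : T ⊆ idealOfVars σ K)
    {f : MvPolynomial σ K} (hf : f ∈ Ideal.span T) :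
    linearPart σ K f ∈ Submodule.span K (linearPart σ K '' T) := by
  induction hf using Submodule.span_induction with
  | mem x hx => exact Submodule.subset_span ⟨x, hx, rfl⟩
  | zero => simp only [map_zero, zero_mem]
  | add x y _ _ hx hy => simpa only [map_add] using add_mem hx hy
  | smul b x hxT hx =>
    rw [smul_eq_mul, linearPart_mul, mem_idealOfVars_iff.1 (Ideal.span_le.2 hT hxT), zero_smul,
      add_zero]
    exact Submodule.smul_mem _ _ hx

end LinearPart

theorem exists_basis_selection {κ σ K : Type*} [Fintype σ] [DecidableEq σ] [Field K]
    (a : κ → σ → K) : ∃ τ : σ → κ ⊕ σ,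
      (Matrix.of fun u => Sum.elim a (fun v => Pi.single v 1) (τ u)).det ≠ 0 ∧
      Module.finrank K (Submodule.span K (Set.range a)) ≤
        (Finset.univ.filter fun u => (τ u).isLeft).card := by
  classical
  set v : κ ⊕ σ → σ → K := Sum.elim a fun v => Pi.single v 1 with hv
  obtain ⟨b₁, hb₁, -, hspan₁, hli₁⟩ := exists_linearIndepOn_extension (K := K) (v := v)
    (linearIndepOn_empty K v) (Set.empty_subset (Set.range Sum.inl))
  obtain ⟨b₂, -, hb₂, hspan₂, hli₂⟩ := exists_linearIndepOn_extension hli₁ (Set.subset_univ b₁)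
  have span_eq_top : ⊤ ≤ Submodule.span K (Set.range fun i : b₂ => v i) := by
    rw [← (Pi.basisFun K σ).span_eq, Submodule.span_le]
    rintro _ ⟨i, rfl⟩
    have hmem := hspan₂ (Set.mem_image_of_mem v (Set.mem_univ (Sum.inr i)))
    rw [Set.image_eq_range] at hmem
    simpa [hv] using! hmem
  let e := (Pi.basisFun K σ).indexEquiv (Module.Basis.mk hli₂ span_eq_top)
  refine ⟨fun u => (e u).1, ?_, ?_⟩
  · rw [← isUnit_iff_ne_zero, ← Matrix.isUnit_iff_isUnit_det,
      ← Matrix.linearIndependent_rows_iff_isUnit]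
    exact hli₂.comp e e.injective
  · set F := Finset.univ.filter fun u => ((e u).1).isLeft
    have span_le : Submodule.span K (Set.range a) ≤
        Submodule.span K ((F.image fun u => v (e u).1 : Finset (σ → K)) : Set (σ → K)) := by
      rw [Submodule.span_le]
      rintro _ ⟨g, rfl⟩
      refine Submodule.span_mono ?_ (hspan₁ (Set.mem_image_of_mem v (Set.mem_range_self g)))
      rintro _ ⟨i, hi, rfl⟩
      refine Finset.mem_coe.2 (Finset.mem_image.2 ⟨e.symm ⟨i, hb₂ hi⟩, ?_, by simp⟩)
      obtain ⟨g, rfl⟩ := hb₁ hi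
      simp [F]
    exact (Submodule.finrank_mono span_le).trans
      ((finrank_span_finset_le_card _).trans Finset.card_image_le)

section Selection

variable {κ σ R : Type*} [CommRing R]

/-- The system of coordinates that consists of the equations and the variables picked by `τ`. -/
noncomputable def selectedCoordinates (G : κ → MvPolynomial σ R) (τ : σ → κ ⊕ σ) (u : σ) :
    MvPolynomial σ R :=
  Sum.elim G X (τ u)

/-- The positions at which `τ` picks an equation rather than a variable. -/
def equationIndices [Fintype σ] (τ : σ → κ ⊕ σ) : Finset σ :=
  Finset.univ.filter fun u => (τ u).isLeft

theorem map_selectedCoordinates {L : Type*} [CommRing L] (g : R →+* L)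
    (G : κ → MvPolynomial σ R) (τ : σ → κ ⊕ σ) (u : σ) :
    map g (selectedCoordinates G τ u) = selectedCoordinates (fun k => map g (G k)) τ u := by
  rw [selectedCoordinates, selectedCoordinates]
  rcases τ u with k | v <;> simp

theorem constantCoeff_selectedCoordinates {G : κ → MvPolynomial σ R}
    (hG : ∀ k, constantCoeff (G k) = 0) (τ : σ → κ ⊕ σ) (u : σ) :
    constantCoeff (selectedCoordinates G τ u) = 0 := by
  rw [selectedCoordinates]
  rcases τ u with k | v
  exacts [hG k, constantCoeff_X _ _]

theorem apply_selectedCoordinates_eq_zero [Fintype σ] {A : Type*} [CommRing A]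
    {θ : MvPolynomial σ R →+* A} {G : κ → MvPolynomial σ R} (hG : ∀ k, θ (G k) = 0)
    {τ : σ → κ ⊕ σ} {u : σ} (hu : u ∈ equationIndices τ) : θ (selectedCoordinates G τ u) = 0 := by
  obtain ⟨k, hk⟩ := Sum.isLeft_iff.1 (Finset.mem_filter.1 hu).2
  rw [selectedCoordinates, hk, Sum.elim_inl, hG]

theorem jacobianMatrix_selectedCoordinates [DecidableEq σ] (G : κ → MvPolynomial σ R)
    (τ : σ → κ ⊕ σ) :
    jacobianMatrix (selectedCoordinates G τ) = Matrix.of fun u =>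
      Sum.elim (fun k => linearPart σ R (G k)) (fun v => Pi.single v 1) (τ u) := by
  ext u v
  rw [jacobianMatrix, Matrix.of_apply, selectedCoordinates]
  rcases τ u with k | w
  · rfl
  · rw [Sum.elim_inr, Sum.elim_inr, ← linearPart_X, linearPart_apply]

theorem jacobianMatrix_map {L : Type*} [CommRing L] (g : R →+* L) (Y : σ → MvPolynomial σ R) :
    (jacobianMatrix fun u => map g (Y u)) = (jacobianMatrix Y).map g := by
  ext u v
  simp only [jacobianMatrix, coeff_map, Matrix.map_apply]

end Selection

section Equations

variable {κ σ K A : Type*} [Field K] [CommRing A] {θ : MvPolynomial σ K →+* A}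
  {G : κ → MvPolynomial σ K}

/-- The equations `G` generate the kernel of `θ` after localization at the origin. -/
structure GeneratesKerAtOrigin (θ : MvPolynomial σ K →+* A) (G : κ → MvPolynomial σ K) :
    Prop where
  apply_eq_zero (k : κ) : θ (G k) = 0
  exists_mul_mem {f : MvPolynomial σ K} (hf : θ f = 0) :
    ∃ u, constantCoeff u ≠ 0 ∧ u * f ∈ Ideal.span (Set.range G)

namespace IsLocalPresentation

theorem constantCoeff_eq_zero [Nontrivial A] (hθ : IsLocalPresentation θ) {f : MvPolynomial σ K}
    (hf : θ f = 0) : constantCoeff f = 0 := by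
  by_contra hne
  exact ((hθ.isUnit_iff f).2 hne).ne_zero hf

theorem exists_finset_map_span_eq_maximalIdeal [Finite σ] [IsLocalRing A]
    (hθ : IsLocalPresentation θ) :
    ∃ T : Finset (MvPolynomial σ K), T.card ≤ (maximalIdeal A).spanFinrank ∧
      (T : Set (MvPolynomial σ K)) ⊆ idealOfVars σ K ∧
        (Ideal.span (T : Set (MvPolynomial σ K))).map θ = maximalIdeal A := by
  classical
  have := hθ.isNoetherianRing
  obtain ⟨s, hcard, hspan⟩ :=
    (IsNoetherian.noetherian (maximalIdeal A)).exists_span_finset_card_eq_spanFinrank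
  choose u g hu hg using hθ.exists_mul_eq
  have subset : (s.image g : Set (MvPolynomial σ K)) ⊆ idealOfVars σ K := by
    rw [Finset.coe_image, Set.image_subset_iff]
    exact fun a ha => mem_idealOfVars_iff.2 <|
      hθ.constantCoeff_eq_zero_of_mul_eq (hspan ▸ Submodule.subset_span ha) (hg a)
  refine ⟨s.image g, Finset.card_image_le.trans hcard.le, subset, le_antisymm ?_ ?_⟩
  · exact (Ideal.map_mono (Ideal.span_le.2 subset)).trans hθ.map_idealOfVars.le
  · rw [← hspan]
    refine Ideal.span_le.2 fun a ha => ?_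
    refine (Ideal.unit_mul_mem_iff_mem _ ((hθ.isUnit_iff _).2 (hu a))).1 ?_
    rw [hg]
    exact Ideal.mem_map_of_mem _
      (Ideal.subset_span (Finset.mem_coe.2 (Finset.mem_image_of_mem g ha)))

theorem span_linearPart_sup_eq_top [Finite σ] [IsLocalRing A] (hθ : IsLocalPresentation θ)
    (hG : GeneratesKerAtOrigin θ G) {T : Set (MvPolynomial σ K)} (hT : T ⊆ idealOfVars σ K)
    (hTθ : (Ideal.span T).map θ = maximalIdeal A) :
    Submodule.span K (Set.range fun k => linearPart σ K (G k)) ⊔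
      Submodule.span K (linearPart σ K '' T) = ⊤ := by
  classical
  rw [eq_top_iff, ← (Pi.basisFun K σ).span_eq, Submodule.span_le]
  rintro _ ⟨i, rfl⟩
  have hXi : θ (X i) ∈ (Ideal.span T).map θ := by
    rw [hTθ, ← hθ.map_idealOfVars]
    exact Ideal.mem_map_of_mem _ (mem_idealOfVars_iff.2 (constantCoeff_X _ _))
  obtain ⟨c, hc, j, hj, hcj⟩ := hθ.exists_mul_eq_of_mem_map hXi
  have hcoeff : constantCoeff (c * X i - j) = 0 := by
    rw [map_sub, map_mul, constantCoeff_X, mul_zero, zero_sub,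
      mem_idealOfVars_iff.1 (Ideal.span_le.2 hT hj), neg_zero]
  obtain ⟨w, hw, hmem⟩ := hG.exists_mul_mem (f := c * X i - j)
    (by rw [map_sub, map_mul, hcj, sub_self])
  have hlin := linearPart_mem_span_image (Set.range_subset_iff.2 fun k =>
    mem_idealOfVars_iff.2 (hθ.constantCoeff_eq_zero (hG.apply_eq_zero k))) hmem
  rw [linearPart_mul, hcoeff, zero_smul, add_zero, map_sub, linearPart_mul, constantCoeff_X,
    zero_smul, add_zero, linearPart_X, ← Set.range_comp, Submodule.smul_mem_iff _ hw] at hlin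
  rw [Pi.basisFun_apply, SetLike.mem_coe, ← Submodule.smul_mem_iff _ hc,
    ← sub_add_cancel (constantCoeff c • (Pi.single i 1 : σ → K)) (linearPart σ K j)]
  exact add_mem (Submodule.mem_sup_left hlin)
    (Submodule.mem_sup_right (linearPart_mem_span_image hT hj))

variable [Fintype σ]

theorem card_le_finrank_add [IsLocalRing A] (hθ : IsLocalPresentation θ)
    (hG : GeneratesKerAtOrigin θ G) :
    Fintype.card σ ≤
      Module.finrank K (Submodule.span K (Set.range fun k => linearPart σ K (G k))) +
        (maximalIdeal A).spanFinrank := by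
  classical
  obtain ⟨T, hcard, hT, hTθ⟩ := hθ.exists_finset_map_span_eq_maximalIdeal
  have hle := Submodule.finrank_add_le_finrank_add_finrank
    (Submodule.span K (Set.range fun k => linearPart σ K (G k)))
    (Submodule.span K (linearPart σ K '' T))
  rw [hθ.span_linearPart_sup_eq_top hG hT hTθ, finrank_top,
    Module.finrank_fintype_fun_eq_card] at hle
  refine hle.trans (Nat.add_le_add_left ?_ _)
  rw [← Finset.coe_image]
  exact (finrank_span_finset_le_card _).trans (Finset.card_image_le.trans hcard)

variable [DecidableEq σ]

theorem exists_selection [IsRegularLocalRing A] (hθ : IsLocalPresentation θ)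
    (hG : GeneratesKerAtOrigin θ G) :
    ∃ τ : σ → κ ⊕ σ, (jacobianMatrix (selectedCoordinates G τ)).det ≠ 0 ∧
      ((Fintype.card σ - (equationIndices τ).card : ℕ) : WithBot ℕ∞) ≤ ringKrullDim A := by
  obtain ⟨τ, hdet, hle⟩ := exists_basis_selection fun k => linearPart σ K (G k)
  refine ⟨τ, by rwa [jacobianMatrix_selectedCoordinates], ?_⟩
  have hcard := hθ.card_le_finrank_add hG
  rw [← IsRegularLocalRing.spanFinrank_maximalIdeal, Nat.cast_le, equationIndices]
  omega

end IsLocalPresentation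

end Equations

theorem height_add_ringKrullDim_quotient_le {R : Type*} [CommRing R] (P : Ideal R) [P.IsPrime] :
    (P.height : WithBot ℕ∞) + ringKrullDim (R ⧸ P) ≤ ringKrullDim R := by
  have : Nonempty (PrimeSpectrum R) := ⟨⟨P, ‹_›⟩⟩
  have quotient_eq : ringKrullDim (R ⧸ P) = Order.coheight (⟨P, ‹_›⟩ : PrimeSpectrum R) := by
    rw [ringKrullDim_quotient, Order.coheight_eq_krullDim_Ici]
    rfl
  rw [quotient_eq, PrimeSpectrum.height_eq_orderHeight ⟨P, ‹_›⟩, ringKrullDim,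
    Order.krullDim_eq_iSup_height_add_coheight_of_nonempty, ← WithBot.coe_add, WithBot.coe_le_coe]
  exact le_iSup (fun a : PrimeSpectrum R => Order.height a + Order.coheight a) ⟨P, ‹_›⟩

theorem IsLocalPresentation.ringKrullDim_eq_quotient_ker {κ σ K A : Type*} [Finite σ] [Field K]
    [CommRing A] [IsRegularLocalRing A] {θ : MvPolynomial σ K →+* A} {G : κ → MvPolynomial σ K}
    (hθ : IsLocalPresentation θ) (hG : GeneratesKerAtOrigin θ G) :
    ringKrullDim A = ringKrullDim (MvPolynomial σ K ⧸ RingHom.ker θ) := by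
  classical
  have := Fintype.ofFinite σ
  have := isDomain_of_isRegularLocalRing A
  have := RingHom.ker_isPrime θ
  refine le_antisymm hθ.ringKrullDim_le_quotient_ker ?_
  obtain ⟨τ, hdet, hle⟩ := hθ.exists_selection hG
  have hheight := hθ.card_le_height_ker (constantCoeff_selectedCoordinates
    (fun k => hθ.constantCoeff_eq_zero (hG.apply_eq_zero k)) τ) hdet
    (fun u => apply_selectedCoordinates_eq_zero hG.apply_eq_zero) hle
  have hsum := (add_le_add_left (WithBot.coe_le_coe.2 hheight) _).trans
    (height_add_ringKrullDim_quotient_le (RingHom.ker θ))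
  rw [MvPolynomial.ringKrullDim_of_isNoetherianRing, ringKrullDim_eq_zero_of_field, zero_add,
    Nat.card_eq_fintype_card] at hsum
  refine le_trans ?_ hle
  refine (ENat.WithBot.add_le_add_natCast_right_iff (c := (equationIndices τ).card)).1 ?_
  rw [← Nat.cast_add, Nat.sub_add_cancel (Finset.card_le_univ _), add_comm]
  exact hsum

section MinimalPrime

variable {T A : Type*} [CommRing T] [CommRing A] [Algebra T A] [IsDomain A]

theorem ker_algebraMap_mem_minimalPrimes (M : Submonoid T) [IsLocalization M A] :
    RingHom.ker (algebraMap T A) ∈ minimalPrimes T := by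
  refine ⟨⟨RingHom.ker_isPrime _, bot_le⟩, fun P hP hle t ht => ?_⟩
  obtain ⟨s, hs⟩ := (IsLocalization.map_eq_zero_iff M A t).1 ht
  refine (hP.1.mem_or_mem (hs ▸ zero_mem P : (s : T) * t ∈ P)).resolve_left fun hsP => ?_
  exact (IsLocalization.map_units A s).ne_zero (hle hsP)

theorem ringKrullDim_quotient_ker (M : Submonoid T) [IsLocalization M A] {σ K : Type*} [Field K]
    {π : MvPolynomial σ K →+* T} (hπ : Function.Surjective π) {d : ℕ} (hd : HasPureDimension T d) :
    ringKrullDim (MvPolynomial σ K ⧸ RingHom.ker ((algebraMap T A).comp π)) = d := by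
  rw [← hd _ (ker_algebraMap_mem_minimalPrimes (A := A) M)]
  have ker_eq : RingHom.ker ((algebraMap T A).comp π) =
      RingHom.ker ((Ideal.Quotient.mk (RingHom.ker (algebraMap T A))).comp π) := by
    rw [← RingHom.comap_ker, ← RingHom.comap_ker, Ideal.mk_ker]
  rw [ker_eq]
  exact ringKrullDim_eq_of_ringEquiv (RingHom.quotientKerEquivOfSurjective
    (Ideal.Quotient.mk_surjective.comp hπ))

end MinimalPrime

section LocalizationPresentation

variable {σ K T A : Type*} [Field K] [CommRing T] [CommRing A] [Algebra T A] (n : Ideal T)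
  [n.IsPrime] [IsLocalization.AtPrime A n] {π : MvPolynomial σ K →+* T}

theorem isUnit_algebraMap_comp_iff (hX : ∀ v, π (X v) ∈ n) (u : MvPolynomial σ K) :
    IsUnit ((algebraMap T A).comp π u) ↔ constantCoeff u ≠ 0 := by
  have comap_eq : n.comap π = idealOfVars σ K := by
    have hle : idealOfVars σ K ≤ n.comap π := Ideal.span_le.2 (Set.range_subset_iff.2 hX)
    exact ((isMaximal_idealOfVars (σ := σ) (K := K)).eq_of_le
      (Ideal.comap_ne_top _ ‹n.IsPrime›.ne_top) hle).symm
  rw [RingHom.comp_apply, IsLocalization.AtPrime.isUnit_to_map_iff A n, Ideal.mem_primeCompl_iff,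
    ← Ideal.mem_comap, comap_eq, mem_idealOfVars_iff]

theorem isLocalPresentation_of_atPrime (hπ : Function.Surjective π) (hX : ∀ v, π (X v) ∈ n) :
    IsLocalPresentation ((algebraMap T A).comp π) := by
  refine ⟨isUnit_algebraMap_comp_iff n hX, fun a => ?_⟩
  obtain ⟨⟨t, s⟩, hts⟩ := IsLocalization.surj n.primeCompl a
  obtain ⟨u, hu⟩ := hπ s
  obtain ⟨g, rfl⟩ := hπ t
  refine ⟨u, g, (isUnit_algebraMap_comp_iff (A := A) n hX u).1 ?_, ?_⟩
  · rw [RingHom.comp_apply, hu]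
    exact IsLocalization.map_units A s
  · rw [RingHom.comp_apply, hu, mul_comm]
    exact hts

theorem generatesKerAtOrigin_of_atPrime (hπ : Function.Surjective π) (hX : ∀ v, π (X v) ∈ n)
    {κ : Type*} {G : κ → MvPolynomial σ K} (hG : RingHom.ker π = Ideal.span (Set.range G)) :
    GeneratesKerAtOrigin ((algebraMap T A).comp π) G where
  apply_eq_zero k := by
    have hk : G k ∈ RingHom.ker π := hG ▸ Ideal.subset_span ⟨k, rfl⟩
    rw [RingHom.comp_apply, RingHom.mem_ker.1 hk, map_zero]
  exists_mul_mem {f} hf := by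
    obtain ⟨s, hs⟩ := (IsLocalization.map_eq_zero_iff n.primeCompl A _).1 hf
    obtain ⟨u, hu⟩ := hπ s
    refine ⟨u, (isUnit_algebraMap_comp_iff (A := A) n hX u).1 ?_, ?_⟩
    · rw [RingHom.comp_apply, hu]
      exact IsLocalization.map_units A s
    · rw [← hG, RingHom.mem_ker, map_mul, hu, hs]

theorem ringKrullDim_of_hasPureDimension [Finite σ] [IsRegularLocalRing A]
    (hπ : Function.Surjective π) (hX : ∀ v, π (X v) ∈ n) {d : ℕ} (hd : HasPureDimension T d) :
    ringKrullDim A = d := by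
  have := isDomain_of_isRegularLocalRing A
  have ker_eq : RingHom.ker π = Ideal.span (Set.range (Subtype.val : RingHom.ker π → _)) := by
    rw [Subtype.range_coe, Ideal.span_eq]
  rw [(isLocalPresentation_of_atPrime (A := A) n hπ hX).ringKrullDim_eq_quotient_ker
    (generatesKerAtOrigin_of_atPrime n hπ hX ker_eq)]
  exact ringKrullDim_quotient_ker n.primeCompl hπ hd

end LocalizationPresentation

section Fiber

open TensorProduct

variable {R S : Type*} [CommRing R] [CommRing S] [Algebra R S]

theorem algEquivAux₂_algebraMap (q : Ideal R) [q.IsPrime] (n : Ideal (q.Fiber S)) [n.IsPrime]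
    (s : S) :
    Ideal.Fiber.algEquivAux₂ q n (algebraMap (q.Fiber S) (Localization.AtPrime n) (1 ⊗ₜ s)) =
      Ideal.Quotient.mk _ (algebraMap S _ s) := by
  let : Algebra S (q.Fiber S) := Algebra.TensorProduct.rightAlgebra
  let r : Ideal S := n.comap Algebra.TensorProduct.includeRight
  change Ideal.Fiber.algEquivAux₂ q n (algebraMap S (Localization.AtPrime n) s) =
    algebraMap (S ⧸ q.map (algebraMap R S)) (Localization.AtPrime r ⧸
      (q.map (algebraMap R S)).map (algebraMap S (Localization.AtPrime r))) (Ideal.Quotient.mk _ s)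
  unfold Ideal.Fiber.algEquivAux₂
  rw [AlgEquiv.trans_apply, AlgEquiv.restrictScalars_apply, AlgEquiv.restrictScalars_apply]
  erw [AlgEquiv.commutes]
  rw [show algebraMap S (Localization.AtPrime (n.comap (Ideal.Fiber.algEquivAux₁ q).symm)) s =
      algebraMap (S ⧸ q.map (algebraMap R S)) _ (Ideal.Quotient.mk _ s) from rfl, AlgEquiv.commutes]

theorem exists_isLocalization_atPrime_localFiber (q : Ideal R) [q.IsPrime] (q' : Ideal S)
    [hq' : q'.IsPrime] (h : q'.comap (algebraMap R S) = q) :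
    ∃ (n : Ideal (q.Fiber S)) (_ : n.IsPrime) (_ : Algebra (q.Fiber S) (LocalFiber q q')),
      IsLocalization.AtPrime (LocalFiber q q') n ∧
      (∀ s : S, (1 : q.ResidueField) ⊗ₜ[R] s ∈ n ↔ s ∈ q') ∧
      ∀ s : S, algebraMap (q.Fiber S) (LocalFiber q q') ((1 : q.ResidueField) ⊗ₜ[R] s) =
        Ideal.Quotient.mk _ (algebraMap S _ s) := by
  obtain ⟨n, hn, rfl⟩ : ∃ (n : Ideal (q.Fiber S)) (_ : n.IsPrime),
      q' = n.comap Algebra.TensorProduct.includeRight := by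
    let fiberEquiv := PrimeSpectrum.preimageEquivFiber R S ⟨q, ‹_›⟩
    let x : PrimeSpectrum.comap (algebraMap R S) ⁻¹' {⟨q, ‹_›⟩} :=
      ⟨⟨q', hq'⟩, PrimeSpectrum.ext h⟩
    exact ⟨(fiberEquiv x).asIdeal, (fiberEquiv x).isPrime,
      (congrArg (fun y => y.1.asIdeal) (fiberEquiv.symm_apply_apply x)).symm⟩
  let e : Localization.AtPrime n ≃+* LocalFiber q (n.comap Algebra.TensorProduct.includeRight) :=
    (Ideal.Fiber.algEquivAux₂ q n).toRingEquiv
  let algebra : Algebra (q.Fiber S) (LocalFiber q (n.comap Algebra.TensorProduct.includeRight)) :=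
    (e.toRingHom.comp (algebraMap (q.Fiber S) (Localization.AtPrime n))).toAlgebra
  exact ⟨n, hn, algebra, IsLocalization.isLocalization_of_algEquiv n.primeCompl
    (AlgEquiv.ofRingEquiv (f := e) fun _ => rfl), fun s => Iff.rfl, algEquivAux₂_algebraMap q n⟩

end Fiber

section Presentation

variable {R S : Type*} [CommRing R] [CommRing S] [Algebra R S]

theorem comap_comap_algebraMap_of_section {φ : S →+* R}
    (hφ : φ.comp (algebraMap R S) = RingHom.id R) (q : Ideal R) :
    (q.comap φ).comap (algebraMap R S) = q := by
  rw [Ideal.comap_comap, hφ, Ideal.comap_id]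

/-- `π : R[X] → S` is a presentation with relations `G` in which the section
`φ : S → R` of the structure map sends all the variables to `0`, so that the section of
`Spec S → Spec R` given by `φ` is the zero section of the affine space over `Spec R`. -/
structure IsPresentationAlong {σ κ : Type*} (φ : S →+* R) (π : MvPolynomial σ R →ₐ[R] S)
    (G : κ → MvPolynomial σ R) : Prop where
  comp_algebraMap : φ.comp (algebraMap R S) = RingHom.id R
  apply_X : ∀ v, φ (π (X v)) = 0
  surjective : Function.Surjective π
  ker_eq_span : RingHom.ker π = Ideal.span (Set.range G)

namespace IsPresentationAlong

variable {σ κ : Type*} {φ : S →+* R} {π : MvPolynomial σ R →ₐ[R] S} {G : κ → MvPolynomial σ R}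

theorem exists_of_section [Algebra.FiniteType R S] (hφ : φ.comp (algebraMap R S) = RingHom.id R) :
    ∃ (N : ℕ) (π : MvPolynomial (Fin N) R →ₐ[R] S),
      IsPresentationAlong φ π (Subtype.val : RingHom.ker π → MvPolynomial (Fin N) R) := by
  obtain ⟨N, f, hf⟩ := Algebra.FiniteType.iff_quotient_mvPolynomial''.1 ‹Algebra.FiniteType R S›
  let π : MvPolynomial (Fin N) R →ₐ[R] S :=
    aeval fun v => f (X v) - algebraMap R S (φ (f (X v)))
  have comp_translation : π.comp (aeval fun v => X v + C (φ (f (X v)))) = f := by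
    ext v
    simp [π, algHom_C]
  refine ⟨N, π, hφ, fun v => ?_, fun s => ?_, by rw [Subtype.range_coe, Ideal.span_eq]⟩
  · have hφ' : ∀ r, φ (algebraMap R S r) = r := RingHom.congr_fun hφ
    simp [π, hφ']
  · obtain ⟨g, rfl⟩ := hf s
    exact ⟨_, DFunLike.congr_fun comp_translation g⟩

variable (hπ : IsPresentationAlong φ π G)
include hπ

theorem apply_eq_constantCoeff (F : MvPolynomial σ R) : φ (π F) = constantCoeff F := by
  have comp_eq : φ.comp (π : MvPolynomial σ R →+* S) = constantCoeff := by
    refine MvPolynomial.ringHom_ext (fun r => ?_) fun v => ?_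
    · rw [constantCoeff_C, RingHom.comp_apply, RingHom.coe_coe, algHom_C]
      exact RingHom.congr_fun hπ.comp_algebraMap r
    · rw [constantCoeff_X]
      exact hπ.apply_X v
  exact RingHom.congr_fun comp_eq F

theorem constantCoeff_relation (k : κ) : constantCoeff (G k) = 0 := by
  have hk : G k ∈ RingHom.ker π := hπ.ker_eq_span ▸ Ideal.subset_span ⟨k, rfl⟩
  rw [← hπ.apply_eq_constantCoeff, RingHom.mem_ker.1 hk, map_zero]

end IsPresentationAlong

section BaseChange

open TensorProduct

variable {σ : Type*} (π : MvPolynomial σ R →ₐ[R] S)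

variable (K : Type*) [CommRing K] [Algebra R K]

/-- The presentation `K[X] → K ⊗[R] S` obtained from a presentation `R[X] → S` by base change
along `R → K`, with `K ⊗[R] R[X]` identified with `K[X]`. -/
noncomputable def baseChangePresentation : MvPolynomial σ K →ₐ[K] K ⊗[R] S :=
  (Algebra.TensorProduct.map (AlgHom.id K K) π).comp
    (algebraTensorAlgEquiv R K).symm.toAlgHom

theorem baseChangePresentation_map (F : MvPolynomial σ R) :
    baseChangePresentation π K (map (algebraMap R K) F) = 1 ⊗ₜ π F := by
  simp [baseChangePresentation, algebraTensorAlgEquiv_symm_map]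

theorem baseChangePresentation_X (v : σ) :
    baseChangePresentation π K (X v) = 1 ⊗ₜ π (X v) := by
  rw [← baseChangePresentation_map, map_X]

variable {π}

theorem baseChangePresentation_surjective (hπ : Function.Surjective π) :
    Function.Surjective (baseChangePresentation π K) :=
  (Algebra.TensorProduct.map_surjective _ _ Function.surjective_id hπ).comp
    (algebraTensorAlgEquiv R K).symm.surjective

theorem ker_baseChangePresentation (hπ : Function.Surjective π) {κ : Type*}
    {G : κ → MvPolynomial σ R} (hG : RingHom.ker π = Ideal.span (Set.range G)) :
    RingHom.ker (baseChangePresentation π K) =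
      Ideal.span (Set.range fun k => map (algebraMap R K) (G k)) := by
  have span_map_eq : Ideal.span (Set.range fun k => map (algebraMap R K) (G k)) =
      ((Ideal.span (Set.range G)).map
        (Algebra.TensorProduct.includeRight : _ →ₐ[R] K ⊗[R] MvPolynomial σ R)).map
          (algebraTensorAlgEquiv (σ := σ) R K) := by
    rw [Ideal.map_span, Ideal.map_span, ← Set.range_comp, ← Set.range_comp]
    simp only [Function.comp_def, Algebra.TensorProduct.includeRight_apply,
      algebraTensorAlgEquiv_tmul, one_smul]
  ext f
  change (algebraTensorAlgEquiv R K).symm f ∈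
    RingHom.ker (Algebra.TensorProduct.map (AlgHom.id R K) π) ↔ _
  rw [Algebra.TensorProduct.lTensor_ker _ hπ, hG, span_map_eq, Ideal.mem_map_of_equiv]
  exact ⟨fun h => ⟨_, h, AlgEquiv.apply_symm_apply _ _⟩,
    by rintro ⟨x, hx, rfl⟩; rwa [AlgEquiv.symm_apply_apply]⟩

end BaseChange

theorem isRegularLocalRing_localFiber (q : Ideal R) [q.IsPrime] [IsRegularRing (q.Fiber S)]
    (q' : Ideal S) [q'.IsPrime] (h : q'.comap (algebraMap R S) = q) :
    IsRegularLocalRing (LocalFiber q q') := by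
  obtain ⟨n, _, _, _, -, -⟩ := exists_isLocalization_atPrime_localFiber q q' h
  exact IsRegularLocalRing.of_ringEquiv (R := Localization.AtPrime n)
    (IsLocalization.algEquiv n.primeCompl (Localization.AtPrime n) (LocalFiber q q')).toRingEquiv

namespace IsPresentationAlong

open TensorProduct

variable {σ κ : Type*} {φ : S →+* R} {π : MvPolynomial σ R →ₐ[R] S} {G : κ → MvPolynomial σ R}
  (hπ : IsPresentationAlong φ π G)
include hπ

theorem baseChangePresentation_X_mem {q : Ideal R} [q.IsPrime] {n : Ideal (q.Fiber S)}
    (mem_iff : ∀ s : S, (1 : q.ResidueField) ⊗ₜ[R] s ∈ n ↔ s ∈ q.comap φ) (v : σ) :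
    baseChangePresentation π q.ResidueField (X v) ∈ n := by
  rw [baseChangePresentation_X, mem_iff, Ideal.mem_comap, hπ.apply_X]
  exact zero_mem q

theorem exists_localFiber_presentation (q : Ideal R) [q.IsPrime] :
    ∃ θ : MvPolynomial σ q.ResidueField →+* LocalFiber q (q.comap φ), IsLocalPresentation θ ∧
      (∀ F, θ (map (algebraMap R _) F) = Ideal.Quotient.mk _ (algebraMap S _ (π F))) ∧
      GeneratesKerAtOrigin θ fun k => map (algebraMap R q.ResidueField) (G k) := by
  obtain ⟨n, _, _, _, mem_iff, algebraMap_tmul⟩ :=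
    exists_isLocalization_atPrime_localFiber q (q.comap φ)
      (comap_comap_algebraMap_of_section hπ.comp_algebraMap q)
  let ρ : MvPolynomial σ q.ResidueField →+* q.Fiber S := baseChangePresentation π q.ResidueField
  have hρ : Function.Surjective ρ := baseChangePresentation_surjective _ hπ.surjective
  have hρX : ∀ v, ρ (X v) ∈ n := hπ.baseChangePresentation_X_mem mem_iff
  refine ⟨(algebraMap (q.Fiber S) (LocalFiber q (q.comap φ))).comp ρ,
    isLocalPresentation_of_atPrime n hρ hρX, fun F => ?_,
    generatesKerAtOrigin_of_atPrime n hρ hρX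
      (ker_baseChangePresentation _ hπ.surjective hπ.ker_eq_span)⟩
  rw [← algebraMap_tmul]
  exact congrArg (algebraMap (q.Fiber S) (LocalFiber q (q.comap φ)))
    (baseChangePresentation_map π _ F)

end IsPresentationAlong

theorem ringKrullDim_localFiber [Algebra.FiniteType R S] {φ : S →+* R}
    (hφ : φ.comp (algebraMap R S) = RingHom.id R) (q : Ideal R) [q.IsPrime]
    [IsRegularLocalRing (LocalFiber q (q.comap φ))] {d : ℕ} (hd : HasPureDimension (q.Fiber S) d) :
    ringKrullDim (LocalFiber q (q.comap φ)) = d := by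
  obtain ⟨n, _, _, _, mem_iff, -⟩ := exists_isLocalization_atPrime_localFiber q (q.comap φ)
    (comap_comap_algebraMap_of_section hφ q)
  obtain ⟨N, π, hπ⟩ := IsPresentationAlong.exists_of_section hφ
  exact ringKrullDim_of_hasPureDimension n
    (π := (baseChangePresentation π q.ResidueField).toRingHom)
    (baseChangePresentation_surjective _ hπ.surjective)
    (hπ.baseChangePresentation_X_mem mem_iff) hd

end Presentation

theorem exists_isLUB_mixedValues {σ ι K : Type*} [Fintype ι] [Field K] (p : ℕ) [Fact p.Prime]
    (y : MvPolynomial σ K) (f : ι → MvPolynomial σ K) :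
    ∃ v, IsLUB (mixedValues p y f) v := by
  refine Real.exists_isLUB ⟨0, 0, 0, 0, by simp, by simp, ?_, by simp⟩
    ⟨Fintype.card ι, fun x hx => (mixedValues_subset_Icc hx).2⟩
  simp [mixedPower]

theorem charP_of_natCast_eq_zero {R K : Type*} [CommRing R] [CommRing K] [Nontrivial K]
    [Algebra R K] {p : ℕ} [Fact p.Prime] (hp : (p : R) = 0) : CharP K p := by
  rw [CharP.charP_iff_prime_eq_zero Fact.out, ← map_natCast (algebraMap R K), hp, map_zero]

theorem exists_lt_forall_le_of_finite {α : Type*} [LinearOrder α] {L : Set α} (hL : L.Finite)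
    {a c : α} (hac : a < c) : ∃ c' < c, ∀ v ∈ L, c' < v → c ≤ v := by
  obtain ⟨c', hc', hmax⟩ := Set.exists_max_image _ id
    ((hL.subset (Set.sep_subset L (· < c))).insert a) ⟨a, Set.mem_insert _ _⟩
  refine ⟨c', ?_, fun v hv hlt => ?_⟩
  · rcases hc' with rfl | h
    exacts [hac, h.2]
  · by_contra! hvc
    exact hlt.not_ge (hmax v (Set.mem_insert_of_mem _ ⟨hv, hvc⟩))

theorem localFiberIdeal_span_range {R S ι : Type*} [CommRing R] [CommRing S] [Algebra R S]
    (a : ι → S) (q : Ideal R) (q' : Ideal S) [q'.IsPrime] :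
    localFiberIdeal (Ideal.span (Set.range a)) q q' =
      Ideal.span (Set.range fun j =>
        Ideal.Quotient.mk (extendedPrime q q') (algebraMap S (Localization.AtPrime q') (a j))) := by
  rw [localFiberIdeal, Ideal.map_span, Ideal.map_span, ← Set.range_comp, ← Set.range_comp]
  rfl

/-- The product of the equations among the coordinates selected by `τ`; it is the element `y` for
which the `F`-pure threshold of the quotient by these equations is read off from
`mixedValues p y`. -/
noncomputable def equationProduct {σ κ R : Type*} [Fintype σ] [CommRing R]
    (G : κ → MvPolynomial σ R) (τ : σ → κ ⊕ σ) : MvPolynomial σ R :=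
  ∏ u ∈ equationIndices τ, selectedCoordinates G τ u

namespace IsPresentationAlong

variable {R S σ κ ι : Type*} [CommRing R] [CommRing S] [Algebra R S] {φ : S →+* R}
  {π : MvPolynomial σ R →ₐ[R] S} {G : κ → MvPolynomial σ R} (hπ : IsPresentationAlong φ π G)
  {f : ι → MvPolynomial σ R} {p : ℕ} [Fact p.Prime]
include hπ

section Fintype

variable [Fintype σ] [DecidableEq σ] [Fintype ι]

theorem exists_selection_localFiber (q : Ideal R) [q.IsPrime]
    [IsRegularLocalRing (LocalFiber q (q.comap φ))] :
    ∃ τ : σ → κ ⊕ σ, (jacobianMatrix (selectedCoordinates G τ)).det ∉ q ∧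
      ((Fintype.card σ - (equationIndices τ).card : ℕ) : WithBot ℕ∞) ≤
        ringKrullDim (LocalFiber q (q.comap φ)) := by
  obtain ⟨θ, hθ, -, hG⟩ := hπ.exists_localFiber_presentation q
  obtain ⟨τ, hdet, hle⟩ := hθ.exists_selection hG
  refine ⟨τ, fun h => hdet ?_, hle⟩
  rw [← Ideal.algebraMap_residueField_eq_zero, RingHom.map_det, RingHom.mapMatrix_apply,
    ← jacobianMatrix_map] at h
  simpa only [map_selectedCoordinates] using h

theorem fpt_localFiberIdeal (hp : (p : R) = 0) (q : Ideal R) [q.IsPrime]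
    [IsRegularLocalRing (LocalFiber q (q.comap φ))] {τ : σ → κ ⊕ σ}
    (hdet : (jacobianMatrix (selectedCoordinates G τ)).det ∉ q)
    (hcard : ((Fintype.card σ - (equationIndices τ).card : ℕ) : WithBot ℕ∞) ≤
      ringKrullDim (LocalFiber q (q.comap φ)))
    (hf : ∀ j, π (f j) ∈ q.comap φ) {v : ℝ}
    (hv : IsLUB (mixedValues p (map (algebraMap R q.ResidueField) (equationProduct G τ))
      fun j => map (algebraMap R q.ResidueField) (f j)) v) :
    fpt p (localFiberIdeal (Ideal.span (Set.range fun j => π (f j))) q (q.comap φ)) =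
      ENNReal.ofReal v := by
  obtain ⟨θ, hθ, θ_map, hG⟩ := hπ.exists_localFiber_presentation q
  have : CharP q.ResidueField p := charP_of_natCast_eq_zero hp
  have : CharP (LocalFiber q (q.comap φ)) p := charP_of_natCast_eq_zero hp
  rw [equationProduct, map_prod] at hv
  simp only [map_selectedCoordinates] at hv
  have ideal_eq : localFiberIdeal (Ideal.span (Set.range fun j => π (f j))) q (q.comap φ) =
      Ideal.span (Set.range fun j => θ (map (algebraMap R q.ResidueField) (f j))) := by
    simp only [localFiberIdeal_span_range, θ_map]
  rw [ideal_eq]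
  refine hθ.fpt_eq (constantCoeff_selectedCoordinates (fun k => ?_) τ) ?_
    (fun u hu => apply_selectedCoordinates_eq_zero hG.apply_eq_zero hu) hcard (fun j => ?_) hv
  · rw [constantCoeff_map, hπ.constantCoeff_relation, map_zero]
  · rw [← funext (map_selectedCoordinates _ G τ), jacobianMatrix_map,
      ← RingHom.mapMatrix_apply, ← RingHom.map_det]
    exact fun h => hdet (Ideal.algebraMap_residueField_eq_zero.1 h)
  · rw [constantCoeff_map, Ideal.algebraMap_residueField_eq_zero, ← hπ.apply_eq_constantCoeff]
    exact hf j

theorem lt_fpt_localFiberIdeal_iff (hp : (p : R) = 0) (q : Ideal R) [q.IsPrime]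
    [IsRegularLocalRing (LocalFiber q (q.comap φ))] {τ : σ → κ ⊕ σ}
    (hdet : (jacobianMatrix (selectedCoordinates G τ)).det ∉ q)
    (hcard : ((Fintype.card σ - (equationIndices τ).card : ℕ) : WithBot ℕ∞) ≤
      ringKrullDim (LocalFiber q (q.comap φ)))
    (hf : ∀ j, π (f j) ∈ q.comap φ) {c : ℝ≥0∞} (hc : c ≠ ⊤) :
    c < fpt p (localFiberIdeal (Ideal.span (Set.range fun j => π (f j))) q (q.comap φ)) ↔
      ∃ x ∈ mixedValues p (map (algebraMap R q.ResidueField) (equationProduct G τ))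
        (fun j => map (algebraMap R q.ResidueField) (f j)), c.toReal < x := by
  obtain ⟨v, hv⟩ := exists_isLUB_mixedValues p
    (map (algebraMap R q.ResidueField) (equationProduct G τ))
    fun j => map (algebraMap R q.ResidueField) (f j)
  rw [hπ.fpt_localFiberIdeal hp q hdet hcard hf hv, ENNReal.lt_ofReal_iff_toReal_lt hc,
    lt_isLUB_iff hv]

theorem fpt_localFiberIdeal_mem_possibleThresholds (hp : (p : R) = 0) (q : Ideal R) [q.IsPrime]
    [IsRegularLocalRing (LocalFiber q (q.comap φ))] {τ : σ → κ ⊕ σ}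
    (hdet : (jacobianMatrix (selectedCoordinates G τ)).det ∉ q)
    (hcard : ((Fintype.card σ - (equationIndices τ).card : ℕ) : WithBot ℕ∞) ≤
      ringKrullDim (LocalFiber q (q.comap φ)))
    (hf : ∀ j, π (f j) ∈ q.comap φ) :
    fpt p (localFiberIdeal (Ideal.span (Set.range fun j => π (f j))) q (q.comap φ)) ∈
      ENNReal.ofReal '' possibleThresholds p (Fintype.card ι)
        (monomialCount σ ((equationProduct G τ).totalDegree + ∑ j, (f j).totalDegree) + 2) := by
  obtain ⟨v, hv⟩ := exists_isLUB_mixedValues p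
    (map (algebraMap R q.ResidueField) (equationProduct G τ))
    fun j => map (algebraMap R q.ResidueField) (f j)
  have : CharP q.ResidueField p := charP_of_natCast_eq_zero hp
  rw [hπ.fpt_localFiberIdeal hp q hdet hcard hf hv]
  exact ⟨v, mem_possibleThresholds (add_le_add (totalDegree_map_le _ _)
    (Finset.sum_le_sum fun j _ => totalDegree_map_le _ (f j))) hv, rfl⟩

end Fintype

theorem isOpen_setOf_lt_fpt_localFiberIdeal [Fintype σ] [DecidableEq σ] [Finite ι]
    (hp : (p : R) = 0) (d : ℕ)
    (hreg : ∀ q : PrimeSpectrum R, IsRegularLocalRing (LocalFiber q.asIdeal (q.asIdeal.comap φ)))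
    (hd : ∀ q : PrimeSpectrum R, ringKrullDim (LocalFiber q.asIdeal (q.asIdeal.comap φ)) = d)
    (hf : ∀ (q : PrimeSpectrum R) j, π (f j) ∈ q.asIdeal.comap φ) {τ : σ → κ ⊕ σ}
    (hcard : Fintype.card σ - (equationIndices τ).card ≤ d) {c : ℝ≥0∞}
    (hc : c ≠ ⊤) : IsOpen {q : PrimeSpectrum R |
      (jacobianMatrix (selectedCoordinates G τ)).det ∉ q.asIdeal ∧
        c < fpt p (localFiberIdeal (Ideal.span (Set.range fun j => π (f j))) q.asIdeal
          (q.asIdeal.comap φ))} := by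
  cases nonempty_fintype ι
  rw [isOpen_iff_mem_nhds]
  rintro q₀ ⟨hdet, hlt⟩
  have le_dim (q : PrimeSpectrum R) := (Nat.cast_le.2 hcard).trans (hd q).ge
  obtain ⟨x, ⟨e, i, γ, hi, hγ, hcoeff, rfl⟩, hx⟩ :=
    (hπ.lt_fpt_localFiberIdeal_iff hp q₀.asIdeal hdet (le_dim q₀) (hf q₀) hc).1 hlt
  rw [← map_mixedPower, coeff_map, Ne, Ideal.algebraMap_residueField_eq_zero] at hcoeff
  filter_upwards [PrimeSpectrum.isOpen_basicOpen.mem_nhds hdet,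
    PrimeSpectrum.isOpen_basicOpen.mem_nhds hcoeff] with q hqdet hqcoeff
  refine ⟨hqdet, (hπ.lt_fpt_localFiberIdeal_iff hp q.asIdeal hqdet (le_dim q) (hf q) hc).2
    ⟨_, ⟨e, i, γ, hi, hγ, ?_, rfl⟩, hx⟩⟩
  rw [← map_mixedPower, coeff_map, Ne, Ideal.algebraMap_residueField_eq_zero]
  exact hqcoeff

theorem isOpen_setOf_le_fpt_localFiberIdeal [Finite σ] [Finite ι] (hp : (p : R) = 0) (d : ℕ)
    (hreg : ∀ q : PrimeSpectrum R, IsRegularLocalRing (LocalFiber q.asIdeal (q.asIdeal.comap φ)))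
    (hd : ∀ q : PrimeSpectrum R, ringKrullDim (LocalFiber q.asIdeal (q.asIdeal.comap φ)) = d)
    (hf : ∀ (q : PrimeSpectrum R) j, π (f j) ∈ q.asIdeal.comap φ) (c : ℝ≥0∞) :
    IsOpen {q : PrimeSpectrum R | c ≤
      fpt p (localFiberIdeal (Ideal.span (Set.range fun j => π (f j))) q.asIdeal
        (q.asIdeal.comap φ))} := by
  rcases eq_zero_or_pos c with rfl | hc
  · simp only [zero_le, Set.ofPred_true, isOpen_univ]
  classical
  cases nonempty_fintype σ
  cases nonempty_fintype ι
  rw [isOpen_iff_mem_nhds]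
  intro q₀ hq₀
  obtain ⟨τ, hdet, hcard⟩ := hπ.exists_selection_localFiber q₀.asIdeal
  rw [hd q₀, Nat.cast_le] at hcard
  obtain ⟨c', hc', hgap⟩ := exists_lt_forall_le_of_finite
    ((possibleThresholds_finite (Fact.out : p.Prime) (Fintype.card ι) (monomialCount σ
      ((equationProduct G τ).totalDegree + ∑ j, (f j).totalDegree) + 2)).image ENNReal.ofReal) hc
  filter_upwards [(hπ.isOpen_setOf_lt_fpt_localFiberIdeal hp d hreg hd hf hcard
    hc'.ne_top).mem_nhds ⟨hdet, hc'.trans_le hq₀⟩] with q ⟨hqdet, hlt⟩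
  exact hgap _ (hπ.fpt_localFiberIdeal_mem_possibleThresholds hp q.asIdeal hqdet
    ((Nat.cast_le.2 hcard).trans (hd q).ge) (hf q)) hlt

end IsPresentationAlong

end FThreshold

theorem theorem5p1_general {R S : Type*} [CommRing R] [CommRing S] [Algebra R S]
    [Algebra.FiniteType R S] (p : ℕ) [Fact p.Prime] (hp : (p : R) = 0) (d : ℕ)
    (φ : S →+* R) (hφ : φ.comp (algebraMap R S) = RingHom.id R)
    (hreg : ∀ q : PrimeSpectrum R,
      IsRegularLocalRing (FThreshold.LocalFiber q.asIdeal (q.asIdeal.comap φ)))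
    (hdim : ∀ q : PrimeSpectrum R,
      ringKrullDim (FThreshold.LocalFiber q.asIdeal (q.asIdeal.comap φ)) = d)
    (𝔞 : Ideal S) (h𝔞_fg : 𝔞.FG) (h𝔞 : ∀ q : PrimeSpectrum R, 𝔞 ≤ q.asIdeal.comap φ)
    (c : ℝ≥0∞) :
    IsOpen {q : PrimeSpectrum R |
      c ≤ FThreshold.fpt p (FThreshold.localFiberIdeal 𝔞 q.asIdeal (q.asIdeal.comap φ))} := by
  obtain ⟨N, π, hπ⟩ := FThreshold.IsPresentationAlong.exists_of_section hφ
  obtain ⟨l, a, rfl⟩ := Submodule.fg_iff_exists_fin_generating_family.1 h𝔞_fg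
  choose f hf using fun j => hπ.surjective (a j)
  obtain rfl : (fun j => π (f j)) = a := funext hf
  exact hπ.isOpen_setOf_le_fpt_localFiberIdeal hp d hreg hdim
    (fun q j => h𝔞 q (Ideal.subset_span ⟨j, rfl⟩)) c

theorem theorem5p1 {k R S : Type*} [Field k] [CommRing R] [CommRing S]
    (p : ℕ) [Fact p.Prime] [CharP k p]
    (hk : FiniteDimensional (frobenius k p).fieldRange k)
    [Algebra k R] [Algebra k S] [Algebra R S] [IsScalarTower k R S]
    (hR : Algebra.FiniteType k R) (hS : Algebra.FiniteType k S)
    (d : ℕ)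
    (hreg : ∀ q : PrimeSpectrum R, IsRegularRing (q.asIdeal.Fiber S))
    (hdim : ∀ q : PrimeSpectrum R, FThreshold.HasPureDimension (q.asIdeal.Fiber S) d)
    (φ : S →+* R) (hφ : φ.comp (algebraMap R S) = RingHom.id R)
    (𝔞 : Ideal S) (h𝔞 : ∀ q : PrimeSpectrum R, 𝔞 ≤ q.asIdeal.comap φ)
    (c : ℝ) (hc : 0 ≤ c) :
    IsOpen {q : PrimeSpectrum R |
      ENNReal.ofReal c ≤
        FThreshold.fpt p (FThreshold.localFiberIdeal 𝔞 q.asIdeal (q.asIdeal.comap φ))} := by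
  have : Algebra.FiniteType R S := Algebra.FiniteType.of_restrictScalars_finiteType k R S
  have hp : (p : R) = 0 := by rw [← map_natCast (algebraMap k R), CharP.cast_eq_zero, map_zero]
  have hloc (q : PrimeSpectrum R) := FThreshold.isRegularLocalRing_localFiber q.asIdeal _
    (FThreshold.comap_comap_algebraMap_of_section hφ q.asIdeal)
  exact theorem5p1_general p hp d φ hφ hloc
    (fun q => FThreshold.ringKrullDim_localFiber hφ q.asIdeal (hdim q)) 𝔞
    ((Algebra.FiniteType.isNoetherianRing k S).noetherian 𝔞) h𝔞 _
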